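/- Let $d,n\in\mathbb N$, let $\Sigma\in\mathbb R^{d\times d}$ be symmetric positive definite, let $\eta,\beta_0,\beta_1\in\mathbb R^d$ and $\sigma\in\mathbb R$. Let $(X_i,W_i,\epsilon_i)$, $i=1,\dots,n$, be i.i.d. random triples with values in $\mathbb R^d\times\{0,1\}\times\mathbb R$ such that $X_i\sim\mathcal N(0,\Sigma)$; $P(W_i=1\mid X_i)=1/(1+e^{-\eta^\top X_i})$ almost surely; and $\epsilon_i$ is independent of $(X_i,W_i)$ with $\mathbb E[\epsilon_i]=0$ and $\mathrm{Var}(\epsilon_i)=\sigma^2$ (not necessarily Gaussian). Let $Y_i(w)=\beta_w^\top X_i+\epsilon_i$ be the potential outcomes and $Y_i=Y_i(W_i)$ the observed outcomes. For $w\in\{0,1\}$ put $$N_{1w}=\sum_{i=1}^n\mathbf 1\{W_i=w\},\qquad \widehat\beta_w=\Big(\sum_{i=1}^n\mathbf 1\{W_i=w\}X_iX_i^\top\Big)^{-1}\sum_{i=1}^n\mathbf 1\{W_i=w\}X_iY_i .$$ (a) Conditionally on the group sizes $(N_{11},N_{10})$ (each of which determines the other, since $N_{11}+N_{10}=n$),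 whenever both exceed $d$, the estimators $\widehat\beta_1$ and $\widehat\beta_0$ are almost surely well defined (the Gram matrices are invertible), their coordinates and the products $\widehat\beta_{1,j}\widehat\beta_{0,k}$ are integrable, and $\widehat\beta_1,\widehat\beta_0$ are uncorrelated: $\mathrm{Cov}(\widehat\beta_1,\widehat\beta_0\mid N_{11},N_{10})=0\in\mathbb R^{d\times d}$. (b) For each $w\in\{0,1\}$, conditionally on $N_{1w}=m$ with $d+1<m\le n$, the estimator $\widehat\beta_w$ is almost surely well defined and has square-integrable coordinates, the inverse Gram matrix $\big(\sum_{i}\mathbf 1\{W_i=w\}X_iX_i^\top\big)^{-1}$ has integrable entries, and the covariance matrix of $\widehat\beta_w$ is $$\mathrm{Var}\big(\widehat\beta_w\mid N_{1w}\big)=\sigma^2\,\mathbb E\Big[\Big(\sum_{i=1}^n\mathbf 1\{W_i=w\}X_iX_i^\top\Big)^{-1}\,\Big|\,N_{1w}\Big]=\frac{\sigma^2\,\Sigma^{-1}}{N_{1w}-d-1}.$$ -/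

import Mathlib

open MeasureTheory ProbabilityTheory

noncomputable section

namespace CausalOLS

variable {Ω : Type*} [MeasurableSpace Ω] {n d : ℕ}

/-- The data-generating model for the `n` units on which the outcome models are fitted:
`X i` is the covariate vector, `W i` the binary treatment (`true` is treated, `false` is control)
and `ε i` the outcome noise of unit `i`. The units are i.i.d., the covariates are `N(0, S)`, the
propensity score is logistic, `P(W = 1 | X) = 1 / (1 + exp (- ηᵀ X))`, and the noise is independent
of `(X, W)` with mean `0` and variance `σ ^ 2` (it need not be Gaussian). -/
structure IsModel (P : Measure Ω) (S : Matrix (Fin d) (Fin d) ℝ)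
    (η : EuclideanSpace ℝ (Fin d)) (σ : ℝ)
    (X : Fin n → Ω → EuclideanSpace ℝ (Fin d)) (W : Fin n → Ω → Bool) (ε : Fin n → Ω → ℝ) :
    Prop where
  measurable_X : ∀ i, Measurable (X i)
  measurable_W : ∀ i, Measurable (W i)
  measurable_noise : ∀ i, Measurable (ε i)
  indep : iIndepFun (fun i ω => (X i ω, W i ω, ε i ω)) P
  identDistrib : ∀ i j,
    IdentDistrib (fun ω => (X i ω, W i ω, ε i ω)) (fun ω => (X j ω, W j ω, ε j ω)) P P
  gaussian : ∀ i, P.map (X i) = multivariateGaussian 0 S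
  propensity : ∀ i,
    P[(W i ⁻¹' {true}).indicator (fun _ => (1 : ℝ)) | MeasurableSpace.comap (X i) inferInstance]
      =ᵐ[P] fun ω => Real.sigmoid (inner ℝ η (X i ω))
  indep_noise : ∀ i, IndepFun (ε i) (fun ω => (X i ω, W i ω)) P
  memLp_noise : ∀ i, MemLp (ε i) 2 P
  mean_noise : ∀ i, ∫ ω, ε i ω ∂P = 0
  variance_noise : ∀ i, variance (ε i) P = σ ^ 2

/-- The potential outcome `Y_i(w) = β_wᵀ X_i + ε_i`. -/
def potentialOutcome (β : Bool → EuclideanSpace ℝ (Fin d))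
    (X : Fin n → Ω → EuclideanSpace ℝ (Fin d)) (ε : Fin n → Ω → ℝ)
    (w : Bool) (i : Fin n) (ω : Ω) : ℝ :=
  inner ℝ (β w) (X i ω) + ε i ω

/-- The observed outcome `Y_i = Y_i(W_i)`. -/
def observedOutcome (β : Bool → EuclideanSpace ℝ (Fin d))
    (X : Fin n → Ω → EuclideanSpace ℝ (Fin d)) (W : Fin n → Ω → Bool) (ε : Fin n → Ω → ℝ)
    (i : Fin n) (ω : Ω) : ℝ :=
  potentialOutcome β X ε (W i ω) i ω

/-- The number of units with treatment status `w`. -/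
def groupSize (W : Fin n → Ω → Bool) (w : Bool) (ω : Ω) : ℕ :=
  (Finset.univ.filter fun i => W i ω = w).card

/-- The Gram matrix `∑ᵢ 1{W_i = w} X_i X_iᵀ`. -/
def gram (X : Fin n → Ω → EuclideanSpace ℝ (Fin d)) (W : Fin n → Ω → Bool) (w : Bool) (ω : Ω) :
    Matrix (Fin d) (Fin d) ℝ :=
  ∑ i, if W i ω = w then Matrix.vecMulVec (X i ω).ofLp (X i ω).ofLp else 0

/-- The least squares coefficients
`(∑ᵢ 1{W_i = w} X_i X_iᵀ)⁻¹ ∑ᵢ 1{W_i = w} Y_i X_i` of the regression of `Y` on `X` in group `w`. -/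
def ols (X : Fin n → Ω → EuclideanSpace ℝ (Fin d)) (W : Fin n → Ω → Bool) (Y : Fin n → Ω → ℝ)
    (w : Bool) (ω : Ω) : Fin d → ℝ :=
  Matrix.mulVec (gram X W w ω)⁻¹ (∑ i, if W i ω = w then Y i ω • (X i ω).ofLp else 0)

/-- The conditional law given that exactly `m` units have treatment status `w`. -/
def condGroupSize (P : Measure Ω) (W : Fin n → Ω → Bool) (w : Bool) (m : ℕ) : Measure Ω :=
  ProbabilityTheory.cond P {ω | groupSize W w ω = m}

/-- The entrywise mean of a random matrix. -/
def meanMatrix (Q : Measure Ω) (A : Ω → Matrix (Fin d) (Fin d) ℝ) : Matrix (Fin d) (Fin d) ℝ :=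
  Matrix.of fun j k => ∫ ω, A ω j k ∂Q

/-- The cross-covariance matrix `Cov(U_j, V_k)` of two random vectors; the covariance matrix of `U`
is `covMatrix Q U U`. -/
def covMatrix (Q : Measure Ω) (U V : Ω → Fin d → ℝ) : Matrix (Fin d) (Fin d) ℝ :=
  Matrix.of fun j k => covariance (fun ω => U ω j) (fun ω => V ω k) Q

end CausalOLS

end

open MeasureTheory ProbabilityTheory

noncomputable section

namespace CausalOLS

/-! ### Laplace transform, null subspaces and projections of the standard Gaussian. -/

section GaussianNorm

variable {E : Type*} [NormedAddCommGroup E] [InnerProductSpace ℝ E] [FiniteDimensional ℝ E]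
  [MeasurableSpace E] [BorelSpace E]

/-! Where the Gram matrix G of group v is invertible, the fit equals β_v + Σ_i g_i ε_i, with weights
g_i = 1{W_i = v} G⁻¹ X_i depending on the design (X, W) only (`ols_eq_add_noiseSum`). The noise is
independent of the design and a group size is a function of W, so conditioning on it changes neither
this independence nor the law of the noise. Every conditional covariance is therefore σ² E Σ_i g_i
g'_iᵀ. For different groups the weights have disjoint supports, which gives 0; for a single group
Σ_i g_i g_iᵀ = G⁻¹ (`sum_groupWeights_mul`), which gives the first variance formula.

Given W the covariates need not be Gaussian, yet the conditional mean of G⁻¹ is that of an inverse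
Wishart matrix. Indeed G involves X_i only through the even function X_i X_iᵀ; since N(0, Σ) is
symmetric and the logistic function satisfies s(-t) = 1 - s(t), W_i is a fair coin independent of
X_i X_iᵀ (`IsModel.fair_coin`). Given an assignment with m units in the group, G is thus distributed
as an unconditioned sum of m Gaussian outer products.

For the inverse Wishart mean, the rows are written as Σ^{1/2} times the rows of an array with
independent standard Gaussian columns a_1, ..., a_d in ℝ^m. The (j, j) entry of the inverse Gram
matrix of the columns is ‖p‖⁻², with p the projection of a_j orthogonal to the other columns
(`gram_inv_diag`). Given those, p is standard Gaussian in dimension k = m - d + 1, and integrating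
the Laplace transform (1 + 2t)^(-k/2) of ‖p‖² yields E‖p‖⁻² = 1/(k - 2) = 1/(m - d - 1).
Off-diagonal entries have mean zero because a_j and -a_j have the same law.

Integrability is delicate in the uncorrelatedness claim: for group size d + 1 square integrability
of the weights is not available. They are integrable because E‖p‖⁻¹ is finite for k ≥ 2, and
products across groups are integrable because, for a frozen assignment, the groups use disjoint and
independent covariates. Passing to the event {W = c} merely restricts the measure. -/

lemma integral_exp_neg_mul_sq_gaussianReal {t : ℝ} (ht : 0 ≤ t) :
    ∫ x, Real.exp (-t * x ^ 2) ∂(gaussianReal 0 1) = (1 + 2 * t) ^ (-(1 / 2) : ℝ) := by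
  rw [integral_gaussianReal_eq_integral_smul one_ne_zero]
  have h : ∀ x : ℝ, gaussianPDFReal 0 1 x • Real.exp (-t * x ^ 2)
      = (√(2 * Real.pi))⁻¹ * Real.exp (-(t + 1 / 2) * x ^ 2) := fun x => by
    simp only [gaussianPDFReal, smul_eq_mul, NNReal.coe_one, mul_one, sub_zero]
    rw [mul_assoc, ← Real.exp_add]
    ring_nf
  simp_rw [h]
  rw [integral_const_mul, integral_gaussian, ← Real.sqrt_inv, ← Real.sqrt_mul (by positivity),
    Real.rpow_neg (by positivity), ← Real.sqrt_eq_rpow, ← Real.sqrt_inv]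
  congr 1
  have : Real.pi ≠ 0 := Real.pi_ne_zero
  field_simp
  ring

lemma integral_exp_neg_mul_norm_sq_stdGaussian {t : ℝ} (ht : 0 ≤ t) :
    ∫ x, Real.exp (-t * ‖x‖ ^ 2) ∂(stdGaussian E)
      = (1 + 2 * t) ^ (-(Module.finrank ℝ E / 2) : ℝ) := by
  rw [stdGaussian, integral_map (Measurable.aemeasurable (by fun_prop)) (by fun_prop)]
  have h : ∀ x : Fin (Module.finrank ℝ E) → ℝ,
      Real.exp (-t * ‖∑ i, x i • stdOrthonormalBasis ℝ E i‖ ^ 2)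
        = ∏ i, Real.exp (-t * x i ^ 2) := fun x => by
    rw [← Real.exp_sum, ← Finset.mul_sum, ← real_inner_self_eq_norm_sq,
      (stdOrthonormalBasis ℝ E).orthonormal.inner_sum]
    simp [sq]
  simp_rw [h]
  rw [integral_fintype_prod_eq_prod (fun _ (x : ℝ) => Real.exp (-t * x ^ 2))]
  simp_rw [integral_exp_neg_mul_sq_gaussianReal ht]
  rw [Finset.prod_const, Finset.card_univ, Fintype.card_fin, ← Real.rpow_natCast,
    ← Real.rpow_mul (by positivity)]
  congr 1
  ring

lemma lintegral_exp_neg_mul_norm_sq_stdGaussian {t : ℝ} (ht : 0 ≤ t) :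
    ∫⁻ x, ENNReal.ofReal (Real.exp (-t * ‖x‖ ^ 2)) ∂(stdGaussian E)
      = ENNReal.ofReal ((1 + 2 * t) ^ (-(Module.finrank ℝ E / 2) : ℝ)) := by
  rw [← integral_exp_neg_mul_norm_sq_stdGaussian ht, ofReal_integral_eq_lintegral_ofReal]
  · refine Integrable.of_bound (by fun_prop) 1 (ae_of_all _ fun x => ?_)
    rw [Real.norm_eq_abs, Real.abs_exp, Real.exp_le_one_iff]
    have := mul_nonneg ht (sq_nonneg ‖x‖)
    linarith
  · exact ae_of_all _ fun x => (Real.exp_pos _).le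

/-- A nonzero normal vector v of V makes ⟨v, x⟩ a nondegenerate real Gaussian, which has no atom at
0. -/
lemma stdGaussian_submodule_eq_zero {V : Submodule ℝ E} (hV : V ≠ ⊤) :
    stdGaussian E (V : Set E) = 0 := by
  obtain ⟨v, hv, hv0⟩ := Submodule.exists_mem_ne_zero_of_ne_bot
    (mt Submodule.orthogonal_eq_bot_iff.1 hV)
  have hmap := IsGaussian.map_eq_gaussianReal (μ := stdGaussian E) (innerSL ℝ v)
  have hne : (Var[innerSL ℝ v; stdGaussian E]).toNNReal ≠ 0 := by
    rw [variance_dual_stdGaussian, innerSL_apply_norm]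
    simpa using hv0
  have := nullSingletonClass_gaussianReal (μ := (stdGaussian E)[innerSL ℝ v]) hne
  have h0 : (stdGaussian E).map (innerSL ℝ v) {0} = 0 := by rw [hmap]; exact measure_singleton _
  rw [Measure.map_apply (by fun_prop) (measurableSet_singleton _)] at h0
  refine measure_mono_null (fun x hx => ?_) h0
  simpa using (Submodule.mem_orthogonal' V v).1 hv x hx

lemma ae_stdGaussian_notMem {V : Submodule ℝ E} (hV : V ≠ ⊤) :
    ∀ᵐ x ∂(stdGaussian E), x ∉ V := by
  rw [ae_iff]
  simpa using stdGaussian_submodule_eq_zero hV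

lemma ae_stdGaussian_ne_zero (h : 0 < Module.finrank ℝ E) : ∀ᵐ x ∂(stdGaussian E), x ≠ 0 := by
  have : Nontrivial E := Module.nontrivial_of_finrank_pos h
  simpa using ae_stdGaussian_notMem (V := (⊥ : Submodule ℝ E)) bot_ne_top

/-- For t in U, ⟨Px, t⟩ = ⟨x, t⟩, so both characteristic functions are the same function of ‖t‖. -/
lemma map_orthogonalProjection_stdGaussian (U : Submodule ℝ E) :
    (stdGaussian E).map U.orthogonalProjectionOnto = stdGaussian U := by
  apply Measure.ext_of_charFun
  ext t
  rw [charFun_stdGaussian, charFun_apply, integral_map (by fun_prop) (by fun_prop)]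
  have h : ∀ x : E, inner ℝ (U.orthogonalProjectionOnto x) t = inner ℝ x (t : E) := fun x => by
    simp
  simp_rw [h]
  rw [← charFun_apply, charFun_stdGaussian]
  simp

end GaussianNorm

/-! ### One-dimensional integrals behind the inverse moments. -/

lemma lintegral_Ioi_exp_neg_mul {a : ℝ} (ha : 0 < a) :
    ∫⁻ t in Set.Ioi (0 : ℝ), ENNReal.ofReal (Real.exp (-t * a)) = ENNReal.ofReal (1 / a) := by
  rw [← ofReal_integral_eq_lintegral_ofReal]
  · congr 1
    have := integral_exp_mul_Ioi (a := -a) (by linarith) 0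
    simp only [neg_mul, mul_comm a] at this ⊢
    rw [this]
    simp [neg_div]
  · have := integrableOn_exp_mul_Ioi (a := -a) (by linarith) 0
    simpa only [IntegrableOn, neg_mul, mul_comm a] using this
  · exact ae_of_all _ fun x => (Real.exp_pos _).le

lemma lintegral_exp_neg_sq_mul {r : ℝ} (hr : 0 < r) :
    ∫⁻ s : ℝ, ENNReal.ofReal (Real.exp (-s ^ 2 * r ^ 2))
      = ENNReal.ofReal √Real.pi * ENNReal.ofReal (1 / r) := by
  have h : ∀ s : ℝ, -s ^ 2 * r ^ 2 = -(r ^ 2) * s ^ 2 := fun s => by ring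
  simp_rw [h]
  rw [← ofReal_integral_eq_lintegral_ofReal, integral_gaussian,
    ← ENNReal.ofReal_mul (by positivity), Real.sqrt_div' _ (by positivity), Real.sqrt_sq hr.le]
  · congr 1; ring
  · exact integrable_exp_neg_mul_sq (by positivity)
  · exact ae_of_all _ fun x => (Real.exp_pos _).le

/-- Source of the constant 1/(k - 2): the integrand is the Laplace transform of ‖Z‖² in dimension k,
and an antiderivative is explicit. -/
lemma lintegral_Ioi_one_add_two_mul_rpow {k : ℝ} (hk : 2 < k) :
    ∫⁻ t in Set.Ioi (0 : ℝ), ENNReal.ofReal ((1 + 2 * t) ^ (-(k / 2)))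
      = ENNReal.ofReal (1 / (k - 2)) := by
  have hd : ∀ t ∈ Set.Ici (0 : ℝ),
      HasDerivAt (fun t : ℝ => -(1 / (k - 2)) * (1 + 2 * t) ^ (1 - k / 2))
        ((1 + 2 * t) ^ (-(k / 2))) t := fun t ht => by
    have hpos : 0 < 1 + 2 * t := by have : (0 : ℝ) ≤ t := ht; positivity
    have h1 : HasDerivAt (fun t : ℝ => 1 + 2 * t) 2 t := by
      simpa using ((hasDerivAt_id t).const_mul 2).const_add 1
    have h2 := (h1.rpow_const (p := 1 - k / 2) (Or.inl hpos.ne')).const_mul (-(1 / (k - 2)))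
    have hk' : k - 2 ≠ 0 := by linarith
    rw [show 1 - k / 2 - 1 = -(k / 2) by ring, ← mul_assoc,
      show -(1 / (k - 2)) * (2 * (1 - k / 2)) = 1 by field_simp; ring, one_mul] at h2
    exact h2
  have hlim : Filter.Tendsto (fun t : ℝ => -(1 / (k - 2)) * (1 + 2 * t) ^ (1 - k / 2))
      Filter.atTop (nhds 0) := by
    have h1 : Filter.Tendsto (fun t : ℝ => 1 + 2 * t) Filter.atTop Filter.atTop :=
      Filter.tendsto_atTop_add_const_left _ _
        (Filter.tendsto_id.const_mul_atTop (by norm_num))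
    have h2 := (tendsto_rpow_neg_atTop (y := k / 2 - 1) (by linarith)).comp h1
    have h3 := h2.const_mul (-(1 / (k - 2)))
    simpa [Function.comp_def, neg_sub] using h3
  have hnn : ∀ t ∈ Set.Ioi (0 : ℝ), 0 ≤ (1 + 2 * t) ^ (-(k / 2)) := fun t ht => by
    have : (0 : ℝ) < t := ht
    positivity
  rw [← ofReal_integral_eq_lintegral_ofReal
    (integrableOn_Ioi_deriv_of_nonneg' hd hnn hlim)
    ((ae_restrict_iff' measurableSet_Ioi).2 (ae_of_all _ hnn)),
    integral_Ioi_of_hasDerivAt_of_nonneg' hd hnn hlim]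
  simp

lemma lintegral_one_add_two_mul_sq_rpow_lt_top {k : ℝ} (hk : 2 ≤ k) :
    ∫⁻ s : ℝ, ENNReal.ofReal ((1 + 2 * s ^ 2) ^ (-(k / 2))) < ⊤ := by
  refine lt_of_le_of_lt (lintegral_mono fun s => ?_)
    integrable_inv_one_add_sq.lintegral_lt_top
  apply ENNReal.ofReal_le_ofReal
  calc (1 + 2 * s ^ 2) ^ (-(k / 2)) ≤ (1 + 2 * s ^ 2) ^ (-1 : ℝ) :=
        Real.rpow_le_rpow_of_exponent_le (by nlinarith [sq_nonneg s]) (by linarith)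
    _ ≤ (1 + s ^ 2)⁻¹ := by
        rw [Real.rpow_neg_one]
        exact inv_anti₀ (by positivity) (by nlinarith [sq_nonneg s])

/-! ### Inverse moments of the Gaussian norm. -/

section GaussianInverse

variable {E : Type*} [NormedAddCommGroup E] [InnerProductSpace ℝ E] [FiniteDimensional ℝ E]
  [MeasurableSpace E] [BorelSpace E]

/-- The inverse second moment of the norm of a standard Gaussian vector. -/
lemma lintegral_inv_norm_sq_stdGaussian (h : 2 < Module.finrank ℝ E) :
    ∫⁻ x, ENNReal.ofReal (1 / ‖x‖ ^ 2) ∂(stdGaussian E)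
      = ENNReal.ofReal (1 / ((Module.finrank ℝ E : ℝ) - 2)) := by
  -- 1/r² is the integral of exp(-t r²) over t > 0. The origin must be discarded: there the left
  -- side is 0 by the convention 1/0 = 0, and the right side is infinite.
  have h1 : ∫⁻ x, ENNReal.ofReal (1 / ‖x‖ ^ 2) ∂(stdGaussian E)
      = ∫⁻ x, (∫⁻ t in Set.Ioi (0 : ℝ), ENNReal.ofReal (Real.exp (-t * ‖x‖ ^ 2)))
        ∂(stdGaussian E) := by
    refine lintegral_congr_ae ?_
    filter_upwards [ae_stdGaussian_ne_zero (E := E) (by omega)] with x hx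
    rw [lintegral_Ioi_exp_neg_mul (by positivity)]
  rw [h1, lintegral_lintegral_swap (Measurable.aemeasurable (by fun_prop)),
    ← lintegral_Ioi_one_add_two_mul_rpow (by exact_mod_cast h)]
  exact setLIntegral_congr_fun measurableSet_Ioi fun t ht =>
    lintegral_exp_neg_mul_norm_sq_stdGaussian (le_of_lt ht)

/-- The inverse first moment of the norm of a standard Gaussian vector is finite. -/
lemma lintegral_inv_norm_stdGaussian_lt_top (h : 2 ≤ Module.finrank ℝ E) :
    ∫⁻ x, ENNReal.ofReal (1 / ‖x‖) ∂(stdGaussian E) < ⊤ := by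
  have hpi : ENNReal.ofReal √Real.pi ≠ 0 := by simp [Real.pi_pos]
  -- Here √π/r is the integral of exp(-s² r²) over the line; after the swap the integrand (1 +
  -- 2s²)^(-k/2) is integrable already at k = 2.
  have h1 : ENNReal.ofReal √Real.pi * ∫⁻ x, ENNReal.ofReal (1 / ‖x‖) ∂(stdGaussian E)
      = ∫⁻ x, (∫⁻ s : ℝ, ENNReal.ofReal (Real.exp (-s ^ 2 * ‖x‖ ^ 2))) ∂(stdGaussian E) := by
    rw [← lintegral_const_mul _ (by fun_prop)]
    refine lintegral_congr_ae ?_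
    filter_upwards [ae_stdGaussian_ne_zero (E := E) (by omega)] with x hx
    rw [lintegral_exp_neg_sq_mul (by positivity)]
  rw [lintegral_lintegral_swap (Measurable.aemeasurable (by fun_prop))] at h1
  simp_rw [lintegral_exp_neg_mul_norm_sq_stdGaussian (sq_nonneg _)] at h1
  have h2 := lintegral_one_add_two_mul_sq_rpow_lt_top (k := Module.finrank ℝ E)
    (by exact_mod_cast h)
  rw [← h1] at h2
  exact ENNReal.lt_top_of_mul_ne_top_right h2.ne hpi

end GaussianInverse

/-- The inverse first moment of the norm of a `k`-dimensional standard Gaussian vector. -/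
def invNormMoment (k : ℕ) : ENNReal :=
  ∫⁻ x, ENNReal.ofReal (1 / ‖x‖) ∂(stdGaussian (EuclideanSpace ℝ (Fin k)))

lemma invNormMoment_lt_top {k : ℕ} (hk : 2 ≤ k) : invNormMoment k < ⊤ :=
  lintegral_inv_norm_stdGaussian_lt_top (by simpa using hk)

/-! ### Inverse moments of projected Gaussian vectors. -/

section Projection

variable {E : Type*} [NormedAddCommGroup E] [InnerProductSpace ℝ E] [FiniteDimensional ℝ E]
  [MeasurableSpace E] [BorelSpace E]

lemma lintegral_inv_norm_stdGaussian :
    ∫⁻ x, ENNReal.ofReal (1 / ‖x‖) ∂(stdGaussian E) = invNormMoment (Module.finrank ℝ E) := by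
  rw [invNormMoment, ← stdGaussian_map (stdOrthonormalBasis ℝ E).repr,
    lintegral_map (by fun_prop) (by fun_prop)]
  simp

lemma lintegral_inv_norm_orthogonalProjection (U : Submodule ℝ E) :
    ∫⁻ x, ENNReal.ofReal (1 / ‖U.orthogonalProjectionOnto x‖) ∂(stdGaussian E)
      = invNormMoment (Module.finrank ℝ U) := by
  rw [← lintegral_inv_norm_stdGaussian (E := U), ← map_orthogonalProjection_stdGaussian,
    lintegral_map (by fun_prop) (by fun_prop)]

lemma lintegral_inv_norm_sq_orthogonalProjection (U : Submodule ℝ E)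
    (h : 2 < Module.finrank ℝ U) :
    ∫⁻ x, ENNReal.ofReal (1 / ‖U.orthogonalProjectionOnto x‖ ^ 2) ∂(stdGaussian E)
      = ENNReal.ofReal (1 / ((Module.finrank ℝ U : ℝ) - 2)) := by
  rw [← lintegral_inv_norm_sq_stdGaussian h, ← map_orthogonalProjection_stdGaussian,
    lintegral_map (by fun_prop) (by fun_prop)]

end Projection

/-! ### Resampling one coordinate of a product measure. -/

section Update

variable {κ : Type*} [Fintype κ] [DecidableEq κ] {α : κ → Type*} [∀ k, MeasurableSpace (α k)]

/-- Replacing coordinate j by an independent copy preserves the product law. This allows integrating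
over one coordinate with the others frozen, without splitting the index type. -/
lemma measurePreserving_update_pi (μ : ∀ k, Measure (α k)) [∀ k, IsProbabilityMeasure (μ k)]
    (j : κ) :
    MeasurePreserving (fun p : (∀ k, α k) × α j => Function.update p.1 j p.2)
      ((Measure.pi μ).prod (μ j)) (Measure.pi μ) := by
  have hm : Measurable (fun p : (∀ k, α k) × α j => Function.update p.1 j p.2) := by
    refine measurable_pi_lambda _ fun k => ?_
    by_cases hk : k = j
    · subst hk; simpa using measurable_snd
    · simp only [Function.update_of_ne hk]
      exact (measurable_pi_apply k).comp measurable_fst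
  refine ⟨hm, ?_⟩
  refine (Measure.pi_eq fun s hs => ?_).symm
  rw [Measure.map_apply hm (MeasurableSet.univ_pi hs)]
  have h : (fun p : (∀ k, α k) × α j => Function.update p.1 j p.2) ⁻¹' (Set.univ.pi s)
      = (Set.univ.pi (Function.update s j Set.univ)) ×ˢ s j := by
    ext ⟨x, y⟩
    simp only [Set.mem_preimage, Set.mem_pi, Set.mem_univ, true_implies, Set.mem_prod]
    constructor
    · intro H
      refine ⟨fun k => ?_, by simpa using H j⟩
      by_cases hk : k = j
      · subst hk; simp
      · simpa [Function.update_of_ne hk] using H k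
    · rintro ⟨H1, H2⟩ k
      by_cases hk : k = j
      · subst hk; simpa using H2
      · simpa [Function.update_of_ne hk] using H1 k
  rw [h, Measure.prod_prod, Measure.pi_pi, ← Finset.prod_erase_mul _ _ (Finset.mem_univ j),
    ← Finset.prod_erase_mul Finset.univ (fun i => μ i (s i)) (Finset.mem_univ j)]
  simp only [Function.update_self, measure_univ, mul_one]
  congr 1
  refine Finset.prod_congr rfl fun k hk => ?_
  rw [Function.update_of_ne (Finset.ne_of_mem_erase hk)]

lemma lintegral_pi_update (μ : ∀ k, Measure (α k)) [∀ k, IsProbabilityMeasure (μ k)] (j : κ)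
    {f : (∀ k, α k) → ENNReal} (hf : AEMeasurable f (Measure.pi μ)) :
    ∫⁻ x, f x ∂(Measure.pi μ)
      = ∫⁻ x, ∫⁻ y, f (Function.update x j y) ∂(μ j) ∂(Measure.pi μ) := by
  have hmp := measurePreserving_update_pi μ j
  rw [← hmp.map_eq] at hf
  conv_lhs => rw [← hmp.map_eq]
  rw [lintegral_map' hf hmp.measurable.aemeasurable,
    lintegral_prod (fun p : (∀ k, α k) × α j => f (Function.update p.1 j p.2))
      (hf.comp_measurable hmp.measurable)]

lemma ae_pi_of_ae_update (μ : ∀ k, Measure (α k)) [∀ k, IsProbabilityMeasure (μ k)] (j : κ)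
    {s : Set (∀ k, α k)} (hs : MeasurableSet s)
    (h : ∀ᵐ x ∂(Measure.pi μ), ∀ᵐ y ∂(μ j), Function.update x j y ∈ s) :
    ∀ᵐ x ∂(Measure.pi μ), x ∈ s := by
  have hmp := measurePreserving_update_pi μ j
  rw [← hmp.map_eq]
  refine (ae_map_iff (p := fun x => x ∈ s) hmp.measurable.aemeasurable hs).2 ?_
  exact (Measure.ae_prod_mem_iff_ae_ae_mem (hmp.measurable hs)).2 h

lemma ae_update_of_ae_pi (μ : ∀ k, Measure (α k)) [∀ k, IsProbabilityMeasure (μ k)] (j : κ)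
    {p : (∀ k, α k) → Prop} (h : ∀ᵐ x ∂(Measure.pi μ), p x) :
    ∀ᵐ x ∂(Measure.pi μ), ∀ᵐ y ∂(μ j), p (Function.update x j y) := by
  have hmp := measurePreserving_update_pi μ j
  exact Measure.ae_ae_of_ae_prod (hmp.quasiMeasurePreserving.ae h)

end Update

/-! ### Dual families and the diagonal of an inverse Gram matrix. -/

section GramInverse

variable {κ : Type*} [Fintype κ] [DecidableEq κ]
  {E : Type*} [NormedAddCommGroup E] [InnerProductSpace ℝ E]

/-- The dual family of `a`, `∑ₖ (G⁻¹)ⱼₖ aₖ` with `G` the Gram matrix of `a`. -/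
def dualFamily (a : κ → E) (j : κ) : E := ∑ k, (Matrix.gram ℝ a)⁻¹ j k • a k

lemma isUnit_gram_of_linearIndependent {a : κ → E} (ha : LinearIndependent ℝ a) :
    IsUnit (Matrix.gram ℝ a) :=
  (Matrix.isUnit_iff_isUnit_det _).2
    (isUnit_iff_ne_zero.2 (Matrix.det_gram_ne_zero_iff_linearIndependent.2 ha))

lemma inner_dualFamily {a : κ → E} (ha : LinearIndependent ℝ a) (j l : κ) :
    inner ℝ (dualFamily a j) (a l) = if j = l then 1 else 0 := by
  have h := Matrix.nonsing_inv_mul (Matrix.gram ℝ a)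
    ((Matrix.isUnit_iff_isUnit_det _).1 (isUnit_gram_of_linearIndependent ha))
  have h' := congrFun (congrFun h j) l
  rw [Matrix.mul_apply, Matrix.one_apply] at h'
  rw [← h', dualFamily, sum_inner]
  exact Finset.sum_congr rfl fun k _ => by rw [real_inner_smul_left, Matrix.gram_apply]

lemma inner_dualFamily_dualFamily {a : κ → E} (ha : LinearIndependent ℝ a) (j k : κ) :
    inner ℝ (dualFamily a j) (dualFamily a k) = (Matrix.gram ℝ a)⁻¹ k j := by
  rw [dualFamily.eq_def a k, inner_sum]
  simp [real_inner_smul_right, inner_dualFamily ha]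

lemma norm_sq_dualFamily {a : κ → E} (ha : LinearIndependent ℝ a) (j : κ) :
    ‖dualFamily a j‖ ^ 2 = (Matrix.gram ℝ a)⁻¹ j j := by
  rw [← real_inner_self_eq_norm_sq, inner_dualFamily_dualFamily ha]

/-- Let u be the dual vector of a_j and p the projection of a_j. Since u is orthogonal to the other
vectors, ⟨u, p⟩ = ⟨u, a_j⟩ = 1; expanding u in the family, only the a_j term pairs nontrivially with
p, so ⟨u, p⟩ is also the diagonal entry times ‖p‖². -/
lemma gram_inv_diag {a : κ → E} [FiniteDimensional ℝ E] (ha : LinearIndependent ℝ a) (j : κ) :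
    (Matrix.gram ℝ a)⁻¹ j j
      = 1 / ‖(Submodule.span ℝ (a '' {j}ᶜ))ᗮ.orthogonalProjectionOnto (a j)‖ ^ 2 := by
  set U := (Submodule.span ℝ (a '' {j}ᶜ))ᗮ with hU
  have hu : dualFamily a j ∈ U := by
    rw [hU, Submodule.mem_orthogonal']
    intro v hv
    induction hv using Submodule.span_induction with
    | mem x hx =>
      obtain ⟨k, hk, rfl⟩ := hx
      rw [inner_dualFamily ha, if_neg (fun h => hk (by simp [h]))]
    | zero => simp
    | add x y _ _ hx hy => rw [inner_add_right, hx, hy, add_zero]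
    | smul c x _ hx => rw [inner_smul_right, hx, mul_zero]
  set p : E := (U.orthogonalProjectionOnto (a j) : E) with hp
  have h1 : inner ℝ (dualFamily a j) p = 1 := by
    have := inner_dualFamily ha j j
    rw [if_pos rfl] at this
    rw [← this]
    exact U.inner_orthogonalProjectionOnto_eq_of_mem_left ⟨_, hu⟩ (a j)
  have h2 : inner ℝ (dualFamily a j) p = (Matrix.gram ℝ a)⁻¹ j j * ‖p‖ ^ 2 := by
    rw [dualFamily, sum_inner, Finset.sum_eq_single j]
    · rw [real_inner_smul_left]
      congr 1
      rw [hp, ← real_inner_self_eq_norm_sq]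
      exact (U.inner_orthogonalProjectionOnto_eq_of_mem_right
        (U.orthogonalProjectionOnto (a j)) (a j)).symm
    · intro k _ hk
      rw [real_inner_smul_left, (Submodule.mem_orthogonal _ _).1
        (U.orthogonalProjectionOnto (a j)).2 (a k) (Submodule.subset_span ⟨k, hk, rfl⟩), mul_zero]
    · simp
  have h3 : (Matrix.gram ℝ a)⁻¹ j j * ‖p‖ ^ 2 = 1 := h2 ▸ h1
  have h4 : ‖p‖ ^ 2 ≠ 0 := fun h => by simp [h] at h3
  exact eq_one_div_of_mul_eq_one_left h3

end GramInverse

/-! ### Measurability of determinants and inverse matrices, by Cramer's rule. -/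

lemma measurable_det {α κ : Type*} [Fintype κ] [DecidableEq κ] [MeasurableSpace α]
    {A : α → Matrix κ κ ℝ} (hA : ∀ j k, Measurable fun x => A x j k) :
    Measurable fun x => (A x).det := by
  simp_rw [Matrix.det_apply]
  exact Finset.measurable_sum _ fun s _ =>
    (Finset.measurable_prod _ fun i _ => hA _ _).const_smul _

lemma measurable_inv_apply {α κ : Type*} [Fintype κ] [DecidableEq κ] [MeasurableSpace α]
    {A : α → Matrix κ κ ℝ} (hA : ∀ j k, Measurable fun x => A x j k) (j k : κ) :
    Measurable fun x => (A x)⁻¹ j k := by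
  simp_rw [Matrix.inv_def, Matrix.smul_apply, Ring.inverse_eq_inv', Matrix.adjugate_apply]
  refine (measurable_det hA).inv.smul (measurable_det fun p q => ?_)
  by_cases hp : p = k
  · subst hp; simp
  · simpa [Matrix.updateRow_ne hp] using hA p q

/-! ### Mean of the inverse Gram matrix of independent standard Gaussian vectors. -/

section StandardDesign

variable {κ : Type*} [Fintype κ] [DecidableEq κ]
  {E : Type*} [NormedAddCommGroup E] [InnerProductSpace ℝ E] [FiniteDimensional ℝ E]
  [MeasurableSpace E] [BorelSpace E]

variable (κ E) in
/-- The law of a family, indexed by `κ`, of independent standard Gaussian vectors of `E`. -/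
abbrev stdDesign : Measure (κ → E) := Measure.pi fun _ => stdGaussian E

omit [Fintype κ] [DecidableEq κ] in
lemma measurable_gram_apply (j k : κ) : Measurable fun a : κ → E => Matrix.gram ℝ a j k := by
  simp only [Matrix.gram_apply]
  fun_prop

lemma measurable_gram_inv_apply (j k : κ) :
    Measurable fun a : κ → E => (Matrix.gram ℝ a)⁻¹ j k :=
  measurable_inv_apply measurable_gram_apply j k

/-- Vectors are added one at a time: fewer than dim E vectors span a proper subspace, which the next
Gaussian vector almost surely avoids. -/
lemma ae_linearIndepOn_stdDesign (s : Finset κ) (hs : s.card ≤ Module.finrank ℝ E) :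
    ∀ᵐ a ∂(stdDesign κ E), LinearIndepOn ℝ a (s : Set κ) := by
  induction s using Finset.induction_on with
  | empty => simp
  | insert j s hj ih =>
    rw [Finset.card_insert_of_notMem hj] at hs
    -- Openness serves only to supply measurability of the event.
    have hopen : IsOpen {a : κ → E | LinearIndepOn ℝ a ((insert j s : Finset κ) : Set κ)} := by
      have h := isOpen_setOfPred_linearIndependent (𝕜 := ℝ) (E := E)
        (ι := ((insert j s : Finset κ) : Set κ))
      have hc : Continuous fun (a : κ → E) (k : ((insert j s : Finset κ) : Set κ)) => a k := by
        fun_prop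
      exact h.preimage hc
    refine ae_pi_of_ae_update _ j hopen.measurableSet ?_
    filter_upwards [ih (by omega)] with a ha
    have hV : Submodule.span ℝ (a '' s) ≠ ⊤ := fun h => by
      classical
      have h1 := finrank_span_finset_le_card (R := ℝ) (s.image a)
      have h2 : (s.image a).card ≤ s.card := Finset.card_image_le
      rw [Finset.coe_image, Set.finrank, h, finrank_top] at h1
      omega
    filter_upwards [ae_stdGaussian_notMem hV] with y hy
    have heq : Set.EqOn (Function.update a j y) a s := fun k hk => by
      rw [Function.update_of_ne]
      rintro rfl
      exact hj hk
    change LinearIndepOn ℝ (Function.update a j y) ((insert j s : Finset κ) : Set κ)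
    rw [Finset.coe_insert, linearIndepOn_insert (by simpa using hj)]
    refine ⟨(linearIndepOn_congr heq).2 ha, ?_⟩
    rwa [Set.image_congr heq, Function.update_self]

lemma ae_linearIndependent_stdDesign (h : Fintype.card κ ≤ Module.finrank ℝ E) :
    ∀ᵐ a ∂(stdDesign κ E), LinearIndependent ℝ a := by
  simpa [linearIndepOn_univ_iff] using ae_linearIndepOn_stdDesign (E := E) (Finset.univ : Finset κ) h

omit [MeasurableSpace E] [BorelSpace E] in
lemma finrank_orthogonal_span_others {a : κ → E} (ha : LinearIndependent ℝ a) (j : κ) :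
    Module.finrank ℝ (Submodule.span ℝ (a '' {j}ᶜ))ᗮ + Fintype.card κ
      = Module.finrank ℝ E + 1 := by
  have h1 := Submodule.finrank_add_finrank_orthogonal (Submodule.span ℝ (a '' {j}ᶜ))
  have h2 : Module.finrank ℝ (Submodule.span ℝ (a '' {j}ᶜ)) + 1 = Fintype.card κ := by
    classical
    have h := finrank_span_set_eq_card (R := ℝ) (s := a '' {j}ᶜ)
      ((ha.linearIndepOn (s := {j}ᶜ)).id_image)
    have := Fintype.card_pos_iff.2 ⟨j⟩
    rw [h, ← Set.ncard_eq_toFinset_card', Set.ncard_image_of_injective _ ha.injective,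
      Set.ncard_compl, Set.ncard_singleton, Nat.card_eq_fintype_card]
    omega
  omega

/-- The projection subspace depends on the vectors other than a_j only and almost surely has
dimension dim E - |κ| + 1, so integrating over a_j alone already gives c. A general f covers both
the entry itself and its square root. -/
lemma lintegral_gram_inv_diag_aux (h : Fintype.card κ ≤ Module.finrank ℝ E) (j : κ)
    {f : ℝ → ENNReal} (hf : Measurable f) {c : ENNReal}
    (hc : ∀ U : Submodule ℝ E, Module.finrank ℝ U + Fintype.card κ = Module.finrank ℝ E + 1 →
      ∫⁻ x, f (1 / ‖U.orthogonalProjectionOnto x‖ ^ 2) ∂(stdGaussian E) = c) :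
    ∫⁻ a, f ((Matrix.gram ℝ a)⁻¹ j j) ∂(stdDesign κ E) = c := by
  rw [lintegral_pi_update _ j (f := fun a => f ((Matrix.gram ℝ a)⁻¹ j j))
    (hf.comp (measurable_gram_inv_apply j j)).aemeasurable]
  have h1 : ∀ᵐ a ∂(stdDesign κ E), ∫⁻ y, f ((Matrix.gram ℝ (Function.update a j y))⁻¹ j j)
      ∂(stdGaussian E) = c := by
    filter_upwards [ae_linearIndependent_stdDesign (E := E) h,
      ae_update_of_ae_pi _ j (ae_linearIndependent_stdDesign (E := E) h)] with a ha hy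
    rw [← hc _ (finrank_orthogonal_span_others ha j)]
    refine lintegral_congr_ae ?_
    filter_upwards [hy] with y hy
    rw [gram_inv_diag hy j]
    have heq : Function.update a j y '' {j}ᶜ = a '' {j}ᶜ :=
      Set.image_congr fun k hk => Function.update_of_ne hk _ _
    rw [Function.update_self]
    -- The type of the projection depends on the set, so the equality is substituted rather than
    -- rewritten.
    have hs : ∀ s : Set E, s = a '' {j}ᶜ →
        f (1 / ‖(Submodule.span ℝ s)ᗮ.orthogonalProjectionOnto y‖ ^ 2)
          = f (1 / ‖(Submodule.span ℝ (a '' {j}ᶜ))ᗮ.orthogonalProjectionOnto y‖ ^ 2) := by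
      rintro _ rfl
      rfl
    exact hs _ heq
  rw [lintegral_congr_ae h1]
  simp

omit [FiniteDimensional ℝ E] [MeasurableSpace E] [BorelSpace E] in
lemma gram_inv_diag_nonneg (a : κ → E) (j : κ) : 0 ≤ (Matrix.gram ℝ a)⁻¹ j j :=
  (Matrix.posSemidef_gram ℝ a).inv.diag_nonneg

lemma lintegral_gram_inv_diag (h : Fintype.card κ + 1 < Module.finrank ℝ E) (j : κ) :
    ∫⁻ a, ENNReal.ofReal ((Matrix.gram ℝ a)⁻¹ j j) ∂(stdDesign κ E)
      = ENNReal.ofReal ((Module.finrank ℝ E : ℝ) - Fintype.card κ - 1)⁻¹ := by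
  refine lintegral_gram_inv_diag_aux (by omega) j ENNReal.measurable_ofReal fun U hU => ?_
  rw [lintegral_inv_norm_sq_orthogonalProjection U (by omega)]
  have : (Module.finrank ℝ U : ℝ) + Fintype.card κ = Module.finrank ℝ E + 1 := by exact_mod_cast hU
  rw [one_div]
  congr 2
  linarith

/-- The square root is an inverse norm in dimension dim E - |κ| + 1 ≥ 2, so one dimension less
suffices than for the entry itself. -/
lemma integrable_sqrt_gram_inv_diag (h : Fintype.card κ < Module.finrank ℝ E) (j : κ) :
    Integrable (fun a => √((Matrix.gram ℝ a)⁻¹ j j)) (stdDesign κ E) := by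
  refine ⟨(measurable_gram_inv_apply j j).sqrt.aestronglyMeasurable, ?_⟩
  rw [hasFiniteIntegral_iff_ofReal (ae_of_all _ fun _ => Real.sqrt_nonneg _)]
  rw [lintegral_gram_inv_diag_aux (f := fun x => ENNReal.ofReal √x) (by omega) j (by fun_prop)
    (c := invNormMoment (Module.finrank ℝ E + 1 - Fintype.card κ))]
  · exact invNormMoment_lt_top (by omega)
  · intro U hU
    rw [← hU, Nat.add_sub_cancel, ← lintegral_inv_norm_orthogonalProjection]
    refine lintegral_congr fun x => ?_
    rw [Real.sqrt_div zero_le_one, Real.sqrt_one, Real.sqrt_sq (norm_nonneg _)]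

lemma integrable_gram_inv_diag (h : Fintype.card κ + 1 < Module.finrank ℝ E) (j : κ) :
    Integrable (fun a => (Matrix.gram ℝ a)⁻¹ j j) (stdDesign κ E) := by
  refine ⟨(measurable_gram_inv_apply j j).aestronglyMeasurable, ?_⟩
  rw [hasFiniteIntegral_iff_ofReal (ae_of_all _ fun _ => gram_inv_diag_nonneg _ _),
    lintegral_gram_inv_diag h]
  exact ENNReal.ofReal_lt_top

lemma integral_gram_inv_diag (h : Fintype.card κ + 1 < Module.finrank ℝ E) (j : κ) :
    ∫ a, (Matrix.gram ℝ a)⁻¹ j j ∂(stdDesign κ E)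
      = ((Module.finrank ℝ E : ℝ) - Fintype.card κ - 1)⁻¹ := by
  rw [integral_eq_lintegral_of_nonneg_ae (ae_of_all _ fun _ => gram_inv_diag_nonneg _ _)
    (measurable_gram_inv_apply j j).aestronglyMeasurable, lintegral_gram_inv_diag h,
    ENNReal.toReal_ofReal]
  have : (Fintype.card κ : ℝ) + 1 < Module.finrank ℝ E := by exact_mod_cast h
  rw [inv_nonneg]
  linarith

/-- Entries are inner products of dual vectors, so Cauchy–Schwarz bounds them by the diagonal
entries. -/
lemma integrable_gram_inv (h : Fintype.card κ + 1 < Module.finrank ℝ E) (j k : κ) :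
    Integrable (fun a => (Matrix.gram ℝ a)⁻¹ j k) (stdDesign κ E) := by
  refine ((integrable_gram_inv_diag (E := E) h j).add (integrable_gram_inv_diag h k)).mono'
    (measurable_gram_inv_apply j k).aestronglyMeasurable ?_
  filter_upwards [ae_linearIndependent_stdDesign (κ := κ) (E := E) (by omega)] with a ha
  have h1 := abs_real_inner_le_norm (dualFamily a k) (dualFamily a j)
  rw [inner_dualFamily_dualFamily ha] at h1
  rw [Real.norm_eq_abs, Pi.add_apply, ← norm_sq_dualFamily ha, ← norm_sq_dualFamily ha]
  nlinarith [sq_nonneg (‖dualFamily a j‖ - ‖dualFamily a k‖), sq_nonneg (‖dualFamily a j‖),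
    sq_nonneg (‖dualFamily a k‖)]

omit [FiniteDimensional ℝ E] [MeasurableSpace E] [BorelSpace E] in
-- Flipping a_j conjugates the Gram matrix by a diagonal sign matrix D with D² = 1, hence conjugates
-- the inverse by D too.
lemma gram_inv_update_neg (a : κ → E) {j k : κ} (hjk : j ≠ k) :
    (Matrix.gram ℝ (Function.update a j (-a j)))⁻¹ j k = -(Matrix.gram ℝ a)⁻¹ j k := by
  let D : Matrix κ κ ℝ := Matrix.diagonal (Function.update 1 j (-1))
  have hD : D * D = 1 := by
    rw [Matrix.diagonal_mul_diagonal, ← Matrix.diagonal_one]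
    congr 1
    ext i
    by_cases hi : i = j
    · subst hi; simp
    · simp [Function.update_of_ne hi]
  have hG : Matrix.gram ℝ (Function.update a j (-a j)) = D * Matrix.gram ℝ a * D := by
    ext p q
    simp only [D, Matrix.mul_diagonal, Matrix.diagonal_mul, Matrix.gram_apply]
    by_cases hp : p = j <;> by_cases hq : q = j <;>
      simp [hp, hq, Function.update_of_ne]
  rw [hG, Matrix.mul_inv_rev, Matrix.mul_inv_rev, Matrix.inv_eq_left_inv hD, ← Matrix.mul_assoc]
  simp [D, Matrix.mul_diagonal, Matrix.diagonal_mul, Function.update_of_ne hjk.symm]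

lemma map_neg_stdGaussian : (stdGaussian E).map (fun x => -x) = stdGaussian E :=
  stdGaussian_map (LinearIsometryEquiv.neg ℝ)

lemma measurePreserving_update_neg (j : κ) :
    MeasurePreserving (fun a : κ → E => Function.update a j (-a j))
      (stdDesign κ E) (stdDesign κ E) := by
  have h := measurePreserving_pi (fun _ : κ => stdGaussian E) (fun _ => stdGaussian E)
    (f := fun k => if k = j then fun x => -x else id) (fun k => by
      by_cases hk : k = j
      · simpa [hk] using ⟨measurable_neg, map_neg_stdGaussian⟩
      · simpa [hk] using MeasurePreserving.id _)
  convert h using 1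
  ext a k
  by_cases hk : k = j
  · subst hk; simp
  · simp [hk]

/-- The integral equals its own negative under the sign flip of a_j; the Bochner convention makes
integrability unnecessary. -/
lemma integral_gram_inv_offDiag {j k : κ} (hjk : j ≠ k) :
    ∫ a, (Matrix.gram ℝ a)⁻¹ j k ∂(stdDesign κ E) = 0 := by
  have hmp := measurePreserving_update_neg (κ := κ) (E := E) j
  have h := integral_map (μ := stdDesign κ E) hmp.measurable.aemeasurable
    (f := fun a => (Matrix.gram ℝ a)⁻¹ j k)
    (measurable_gram_inv_apply j k).aestronglyMeasurable
  rw [hmp.map_eq] at h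
  simp_rw [gram_inv_update_neg _ hjk, integral_neg] at h
  linarith

lemma integral_gram_inv (h : Fintype.card κ + 1 < Module.finrank ℝ E) (j k : κ) :
    ∫ a, (Matrix.gram ℝ a)⁻¹ j k ∂(stdDesign κ E)
      = ((Module.finrank ℝ E : ℝ) - Fintype.card κ - 1)⁻¹ * (1 : Matrix κ κ ℝ) j k := by
  by_cases hjk : j = k
  · subst hjk
    rw [integral_gram_inv_diag h, Matrix.one_apply_eq, mul_one]
  · rw [integral_gram_inv_offDiag hjk, Matrix.one_apply_ne hjk, mul_zero]

end StandardDesign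

/-! ### Reading an i.i.d. array by rows or by columns. -/

section Transpose

variable {ι κ : Type*} [Fintype ι] [Fintype κ] {α : Type*} [MeasurableSpace α]

lemma pi_map_uncurry (μ : Measure α) [IsProbabilityMeasure μ] :
    (Measure.pi fun _ : ι => Measure.pi fun _ : κ => μ).map (fun z (p : ι × κ) => z p.1 p.2)
      = Measure.pi fun _ : ι × κ => μ := by
  refine (Measure.pi_eq fun s hs => ?_).symm
  rw [Measure.map_apply (by fun_prop) (MeasurableSet.univ_pi hs)]
  have h : (fun (z : ι → κ → α) (p : ι × κ) => z p.1 p.2) ⁻¹' (Set.univ.pi s)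
      = Set.univ.pi fun i => Set.univ.pi fun k => s (i, k) := by
    ext z
    simp [Set.mem_pi]
  rw [h, Measure.pi_pi]
  simp_rw [Measure.pi_pi]
  rw [Fintype.prod_prod_type]

lemma pi_map_swap (μ : Measure α) [IsProbabilityMeasure μ] :
    (Measure.pi fun _ : κ => Measure.pi fun _ : ι => μ).map (fun z i k => z k i)
      = Measure.pi fun _ : ι => Measure.pi fun _ : κ => μ := by
  have h1 : (Measure.pi fun _ : κ => Measure.pi fun _ : ι => μ).map
      (fun z (p : ι × κ) => z p.2 p.1) = Measure.pi fun _ : ι × κ => μ := by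
    refine (Measure.pi_eq fun s hs => ?_).symm
    rw [Measure.map_apply (by fun_prop) (MeasurableSet.univ_pi hs)]
    have h : (fun (z : κ → ι → α) (p : ι × κ) => z p.2 p.1) ⁻¹' (Set.univ.pi s)
        = Set.univ.pi fun k => Set.univ.pi fun i => s (i, k) := by
      ext z
      simp only [Set.mem_preimage, Set.mem_pi, Set.mem_univ, true_implies, Prod.forall]
      exact forall_comm
    rw [h, Measure.pi_pi]
    simp_rw [Measure.pi_pi]
    rw [Fintype.prod_prod_type_right]
  have h2 := pi_map_uncurry (ι := ι) (κ := κ) μ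
  have h3 := congrArg (Measure.map fun (z : ι × κ → α) i k => z (i, k)) (h1.trans h2.symm)
  rw [Measure.map_map (by fun_prop) (by fun_prop), Measure.map_map (by fun_prop) (by fun_prop)]
    at h3
  exact h3.trans Measure.map_id

end Transpose

/-! ### From Gaussian columns to regression rows; least squares weights. -/

section Design

open scoped MatrixOrder in
/-- The positive semidefinite square root of a matrix. -/
abbrev sqrtMat {κ : Type*} [Fintype κ] [DecidableEq κ] (S : Matrix κ κ ℝ) : Matrix κ κ ℝ :=
  CFC.sqrt S

variable {ι κ : Type*} [Fintype ι] [Fintype κ] [DecidableEq κ]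

/-- The unnormalized second moment matrix `∑ᵢ xᵢ xᵢᵀ` of a finite family of vectors. -/
def outerSum (x : ι → EuclideanSpace ℝ κ) : Matrix κ κ ℝ :=
  ∑ i, Matrix.vecMulVec (x i).ofLp (x i).ofLp

/-- The rows of the matrix with columns `a`, transformed by `B`. -/
def designRows (B : Matrix κ κ ℝ) (a : κ → EuclideanSpace ℝ ι) (i : ι) : EuclideanSpace ℝ κ :=
  Matrix.toEuclideanCLM (𝕜 := ℝ) B (WithLp.toLp 2 fun k => a k i)

omit [Fintype ι] in
lemma measurable_designRows (B : Matrix κ κ ℝ) :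
    Measurable (designRows B : (κ → EuclideanSpace ℝ ι) → ι → EuclideanSpace ℝ κ) := by
  unfold designRows
  fun_prop

/-- An i.i.d. N(0, 1) array has standard Gaussian columns and standard Gaussian rows; applying
S^{1/2} to the rows gives N(0, S). This turns Wishart questions into geometry of the columns. -/
lemma map_designRows (S : Matrix κ κ ℝ) :
    (stdDesign κ (EuclideanSpace ℝ ι)).map (designRows (sqrtMat S))
      = Measure.pi fun _ : ι => multivariateGaussian 0 S := by
  have h1 : stdDesign κ (EuclideanSpace ℝ ι)
      = (Measure.pi fun _ : κ => Measure.pi fun _ : ι => gaussianReal 0 1).map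
          (fun z k => WithLp.toLp 2 (z k)) := by
    rw [Measure.pi_map_pi (fun _ => Measurable.aemeasurable (by fun_prop))]
    simp_rw [map_pi_eq_stdGaussian]
  have h2 : (Measure.pi fun _ : ι => multivariateGaussian 0 S)
      = (Measure.pi fun _ : ι => Measure.pi fun _ : κ => gaussianReal 0 1).map
          (fun z i => Matrix.toEuclideanCLM (𝕜 := ℝ) (sqrtMat S) (WithLp.toLp 2 (z i))) := by
    rw [Measure.pi_map_pi (f := fun _ z => Matrix.toEuclideanCLM (𝕜 := ℝ) (sqrtMat S)
      (WithLp.toLp 2 z)) (fun _ => Measurable.aemeasurable (by fun_prop))]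
    simp_rw [multivariateGaussian, ← map_pi_eq_stdGaussian]
    congr 1
    ext1 i
    rw [Measure.map_map (by fun_prop) (by fun_prop)]
    simp [Function.comp_def]
  rw [h1, h2, ← pi_map_swap (ι := ι) (κ := κ), Measure.map_map (g := designRows (sqrtMat S))
    (measurable_designRows _) (by fun_prop), Measure.map_map (by fun_prop) (by fun_prop)]
  rfl

lemma outerSum_designRows (B : Matrix κ κ ℝ) (a : κ → EuclideanSpace ℝ ι) :
    outerSum (designRows B a) = B * Matrix.gram ℝ a * B.transpose := by
  have h : Matrix.gram ℝ a = outerSum fun i => WithLp.toLp 2 fun k => a k i := by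
    ext p q
    simp [outerSum, Matrix.sum_apply, Matrix.vecMulVec_apply, PiLp.inner_apply, mul_comm]
  rw [h]
  simp only [outerSum, Matrix.mul_sum, Matrix.sum_mul, designRows]
  refine Finset.sum_congr rfl fun i _ => ?_
  rw [Matrix.mul_vecMulVec, Matrix.vecMulVec_mul, Matrix.vecMul_transpose]
  rfl

/-- The weights `(∑ᵢ xᵢ xᵢᵀ)⁻¹ xᵢ` of the least squares regression on `x`. -/
def weights (x : ι → EuclideanSpace ℝ κ) (i : ι) : κ → ℝ :=
  Matrix.mulVec (outerSum x)⁻¹ (x i).ofLp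

/-- In (B G Bᵀ)⁻¹ B the factor B cancels, leaving B⁻ᵀ applied to the dual family, whose norms are
controlled. -/
lemma weights_designRows {B : Matrix κ κ ℝ} (hB : IsUnit B) (a : κ → EuclideanSpace ℝ ι) (i : ι)
    (j : κ) :
    weights (designRows B a) i j = ∑ p, (B.transpose)⁻¹ j p * dualFamily a p i := by
  rw [weights, outerSum_designRows, Matrix.mul_inv_rev, Matrix.mul_inv_rev]
  have h : (designRows B a i).ofLp = Matrix.mulVec B fun k => a k i := rfl
  rw [h, Matrix.mulVec_mulVec, Matrix.mul_assoc, Matrix.mul_assoc,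
    Matrix.nonsing_inv_mul _ ((Matrix.isUnit_iff_isUnit_det _).1 hB), Matrix.mul_one,
    ← Matrix.mulVec_mulVec]
  simp [Matrix.mulVec, dotProduct, dualFamily]

omit [Fintype κ] [DecidableEq κ] in
lemma measurable_outerSum_apply {α : Type*} [MeasurableSpace α] {x : α → ι → EuclideanSpace ℝ κ}
    (hx : ∀ i, Measurable fun ω => x ω i) (j k : κ) : Measurable fun ω => outerSum (x ω) j k := by
  simp only [outerSum, Matrix.sum_apply, Matrix.vecMulVec_apply]
  fun_prop

lemma measurable_outerSum_inv_apply {α : Type*} [MeasurableSpace α]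
    {x : α → ι → EuclideanSpace ℝ κ} (hx : ∀ i, Measurable fun ω => x ω i) (j k : κ) :
    Measurable fun ω => (outerSum (x ω))⁻¹ j k :=
  measurable_inv_apply (measurable_outerSum_apply hx) j k

lemma measurable_weights {α : Type*} [MeasurableSpace α]
    {x : α → ι → EuclideanSpace ℝ κ} (hx : ∀ i, Measurable fun ω => x ω i) (i : ι) (j : κ) :
    Measurable fun ω => weights (x ω) i j := by
  simp only [weights, Matrix.mulVec, dotProduct]
  refine Finset.measurable_sum _ fun k _ => (measurable_outerSum_inv_apply hx j k).mul ?_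
  have := hx i
  fun_prop

/-- With A = `outerSum x`, the sum of outer products of the weights is A⁻¹ A A⁻¹. -/
lemma sum_weights_mul_weights {x : ι → EuclideanSpace ℝ κ} (hx : IsUnit (outerSum x)) (j k : κ) :
    ∑ i, weights x i j * weights x i k = (outerSum x)⁻¹ j k := by
  have hsymm : (outerSum x).transpose = outerSum x := by
    simp [outerSum, Matrix.transpose_sum, Matrix.transpose_vecMulVec]
  have h : ∑ i, Matrix.vecMulVec (weights x i) (weights x i) = (outerSum x)⁻¹ := by
    have h1 : ∀ i, Matrix.vecMulVec (weights x i) (weights x i)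
        = (outerSum x)⁻¹ * Matrix.vecMulVec (x i).ofLp (x i).ofLp * (outerSum x)⁻¹ := fun i => by
      rw [Matrix.mul_vecMulVec, Matrix.vecMulVec_mul, ← Matrix.mulVec_transpose,
        Matrix.transpose_nonsing_inv, hsymm, weights]
    simp_rw [h1]
    rw [← Finset.sum_mul, ← Finset.mul_sum]
    change (outerSum x)⁻¹ * outerSum x * _ = _
    rw [Matrix.nonsing_inv_mul _ ((Matrix.isUnit_iff_isUnit_det _).1 hx), Matrix.one_mul]
  rw [← h]
  simp [Matrix.sum_apply, Matrix.vecMulVec_apply]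

end Design

/-! ### Invertibility, integrable weights and the inverse Wishart mean for rows N(0, S). -/

section GaussianDesign

variable {ι κ : Type*} [Fintype ι] [Fintype κ] [DecidableEq κ] {S : Matrix κ κ ℝ}

open scoped MatrixOrder in
lemma sqrtMat_mul_transpose (hS : S.PosDef) :
    CFC.sqrt S * (sqrtMat S).transpose = S := by
  have h : (sqrtMat S).IsHermitian := (CFC.sqrt_nonneg S).isSelfAdjoint
  rw [← Matrix.conjTranspose_eq_transpose_of_trivial, h.eq]
  exact CFC.sqrt_mul_sqrt_self S (Matrix.nonneg_iff_posSemidef.2 hS.posSemidef)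

lemma isUnit_sqrtMat (hS : S.PosDef) : IsUnit (sqrtMat S) := by
  rw [Matrix.isUnit_iff_isUnit_det]
  have h := congrArg Matrix.det (sqrtMat_mul_transpose hS)
  rw [Matrix.det_mul] at h
  exact isUnit_of_mul_isUnit_left (h ▸ (Matrix.isUnit_iff_isUnit_det _).1 hS.isUnit)

lemma measurableSet_isUnit_outerSum :
    MeasurableSet {x : ι → EuclideanSpace ℝ κ | IsUnit (outerSum x)} := by
  simp_rw [Matrix.isUnit_iff_isUnit_det, isUnit_iff_ne_zero]
  exact (measurable_det (measurable_outerSum_apply fun i => measurable_pi_apply i))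
    (measurableSet_singleton 0).compl

lemma isUnit_outerSum_designRows (hS : S.PosDef) {a : κ → EuclideanSpace ℝ ι}
    (ha : LinearIndependent ℝ a) : IsUnit (outerSum (designRows (sqrtMat S) a)) := by
  rw [outerSum_designRows]
  exact ((isUnit_sqrtMat hS).mul (isUnit_gram_of_linearIndependent ha)).mul
    ((Matrix.isUnit_transpose _).2 (isUnit_sqrtMat hS))

lemma ae_isUnit_outerSum (hS : S.PosDef) (h : Fintype.card κ ≤ Fintype.card ι) :
    ∀ᵐ x ∂(Measure.pi fun _ : ι => multivariateGaussian 0 S), IsUnit (outerSum x) := by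
  rw [← map_designRows]
  refine (ae_map_iff (p := fun x => IsUnit (outerSum x))
    (measurable_designRows _).aemeasurable measurableSet_isUnit_outerSum).2 ?_
  filter_upwards [ae_linearIndependent_stdDesign (κ := κ) (E := EuclideanSpace ℝ ι) (by simpa)]
    with a ha
  exact isUnit_outerSum_designRows hS ha

/-- A coordinate of a dual vector is at most its norm, the square root of a diagonal entry, so the
half-power moment suffices. -/
lemma integrable_weights (hS : S.PosDef) (h : Fintype.card κ < Fintype.card ι) (i : ι) (j : κ) :
    Integrable (fun x => weights x i j) (Measure.pi fun _ : ι => multivariateGaussian 0 S) := by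
  rw [← map_designRows, integrable_map_measure
    (measurable_weights (fun i => measurable_pi_apply i) i j).aestronglyMeasurable
    (measurable_designRows _).aemeasurable]
  have hint : Integrable (fun a => ∑ p, |((sqrtMat S).transpose)⁻¹ j p|
      * √((Matrix.gram ℝ a)⁻¹ p p)) (stdDesign κ (EuclideanSpace ℝ ι)) :=
    integrable_finsetSum _ fun p _ =>
      (integrable_sqrt_gram_inv_diag (E := EuclideanSpace ℝ ι) (by simpa) p).const_mul _
  refine hint.mono' ((measurable_weights (fun i => measurable_pi_apply i) i j).comp
    (measurable_designRows _)).aestronglyMeasurable ?_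
  filter_upwards [ae_linearIndependent_stdDesign (κ := κ) (E := EuclideanSpace ℝ ι)
    (by simpa using h.le)] with a ha
  rw [Function.comp_apply, weights_designRows (isUnit_sqrtMat hS)]
  refine (norm_sum_le _ _).trans (Finset.sum_le_sum fun p _ => ?_)
  rw [norm_mul, Real.norm_eq_abs, ← norm_sq_dualFamily ha, Real.sqrt_sq (norm_nonneg _)]
  exact mul_le_mul_of_nonneg_left (PiLp.norm_apply_le _ i) (abs_nonneg _)

lemma outerSum_designRows_inv_apply (a : κ → EuclideanSpace ℝ ι) (j k : κ) :
    (outerSum (designRows (sqrtMat S) a))⁻¹ j k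
      = ∑ q, ∑ p, ((sqrtMat S).transpose)⁻¹ j p * (sqrtMat S)⁻¹ q k
          * (Matrix.gram ℝ a)⁻¹ p q := by
  rw [outerSum_designRows, Matrix.mul_inv_rev, Matrix.mul_inv_rev, ← Matrix.mul_assoc,
    Matrix.mul_apply]
  refine Finset.sum_congr rfl fun q _ => ?_
  rw [Matrix.mul_apply, Finset.sum_mul]
  exact Finset.sum_congr rfl fun p _ => by ring

lemma integrable_outerSum_inv (h : Fintype.card κ + 1 < Fintype.card ι)
    (j k : κ) :
    Integrable (fun x => (outerSum x)⁻¹ j k)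
      (Measure.pi fun _ : ι => multivariateGaussian 0 S) := by
  rw [← map_designRows, integrable_map_measure
    (measurable_outerSum_inv_apply (fun i => measurable_pi_apply i) j k).aestronglyMeasurable
    (measurable_designRows _).aemeasurable]
  simp_rw [Function.comp_def, outerSum_designRows_inv_apply]
  exact integrable_finsetSum _ fun q _ => integrable_finsetSum _ fun p _ =>
    (integrable_gram_inv (E := EuclideanSpace ℝ ι) (by simpa) p q).const_mul _

/-- The mean of an inverse Wishart matrix. -/
lemma integral_outerSum_inv (hS : S.PosDef) (h : Fintype.card κ + 1 < Fintype.card ι)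
    (j k : κ) :
    ∫ x, (outerSum x)⁻¹ j k ∂(Measure.pi fun _ : ι => multivariateGaussian 0 S)
      = ((Fintype.card ι : ℝ) - Fintype.card κ - 1)⁻¹ * S⁻¹ j k := by
  rw [← map_designRows, integral_map (measurable_designRows _).aemeasurable
    (measurable_outerSum_inv_apply (fun i => measurable_pi_apply i) j k).aestronglyMeasurable]
  simp_rw [outerSum_designRows_inv_apply]
  have hint := fun p q => integrable_gram_inv (κ := κ) (E := EuclideanSpace ℝ ι) (by simpa) p q
  rw [integral_finsetSum _ fun q _ => integrable_finsetSum _ fun p _ => (hint p q).const_mul _]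
  simp_rw [integral_finsetSum _ fun p _ => (hint p _).const_mul _, integral_const_mul,
    integral_gram_inv (κ := κ) (E := EuclideanSpace ℝ ι) (by simpa)]
  have hS' : S⁻¹ = ((sqrtMat S).transpose)⁻¹ * (sqrtMat S)⁻¹ := by
    rw [← Matrix.mul_inv_rev, sqrtMat_mul_transpose hS]
  rw [hS', Matrix.mul_apply, Finset.mul_sum]
  refine Finset.sum_congr rfl fun q _ => ?_
  rw [Finset.sum_eq_single q]
  · rw [Matrix.one_apply_eq, finrank_euclideanSpace]
    ring
  · intro p _ hp
    rw [Matrix.one_apply_ne hp]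
    ring
  · simp

/-- The square of one weight is at most the sum of squares over all units, a diagonal entry of the
inverse. -/
lemma memLp_weights (hS : S.PosDef) (h : Fintype.card κ + 1 < Fintype.card ι) (i : ι) (j : κ) :
    MemLp (fun x => weights x i j) 2 (Measure.pi fun _ : ι => multivariateGaussian 0 S) := by
  have hm : Measurable fun x : ι → EuclideanSpace ℝ κ => weights x i j :=
    measurable_weights (fun i => measurable_pi_apply i) i j
  rw [memLp_two_iff_integrable_sq hm.aestronglyMeasurable]
  refine (integrable_outerSum_inv h j j).mono' (hm.pow_const 2).aestronglyMeasurable ?_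
  filter_upwards [ae_isUnit_outerSum (ι := ι) hS (by omega)] with x hx
  rw [← sum_weights_mul_weights hx, Real.norm_of_nonneg (sq_nonneg _), sq]
  exact Finset.single_le_sum (f := fun i => weights x i j * weights x i j)
    (fun i _ => mul_self_nonneg _) (Finset.mem_univ i)

end GaussianDesign

/-! ### Independence of families and of fair coins. -/

section Independence

variable {Ω : Type*} [MeasurableSpace Ω] {P : Measure Ω} [IsProbabilityMeasure P]

lemma indepFun_families {ι α β : Type*} [Fintype ι] [MeasurableSpace α] [MeasurableSpace β]
    {A : ι → Ω → α} {B : ι → Ω → β} (hA : ∀ i, Measurable (A i)) (hB : ∀ i, Measurable (B i))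
    (h : iIndepFun (fun i ω => (A i ω, B i ω)) P) (hAB : ∀ i, IndepFun (A i) (B i) P) :
    IndepFun (fun ω i => A i ω) (fun ω i => B i ω) P := by
  have hiA : iIndepFun A P := h.comp (fun _ => Prod.fst) fun _ => measurable_fst
  have hiB : iIndepFun B P := h.comp (fun _ => Prod.snd) fun _ => measurable_snd
  have : ∀ i, IsProbabilityMeasure (P.map (A i)) := fun i =>
    Measure.isProbabilityMeasure_map (hA i).aemeasurable
  have : ∀ i, IsProbabilityMeasure (P.map (B i)) := fun i =>
    Measure.isProbabilityMeasure_map (hB i).aemeasurable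
  rw [indepFun_iff_map_prod_eq_prod_map_map (by fun_prop) (by fun_prop),
    hiA.map_fun_eq_pi_map (fun i => (hA i).aemeasurable),
    hiB.map_fun_eq_pi_map (fun i => (hB i).aemeasurable),
    ← (measurePreserving_arrowProdEquivProdArrow α β ι (fun i => P.map (A i))
      (fun i => P.map (B i))).map_eq]
  have h1 : (Measure.pi fun i => (P.map (A i)).prod (P.map (B i)))
      = P.map (fun ω i => (A i ω, B i ω)) := by
    rw [h.map_fun_eq_pi_map (fun i => ((hA i).prodMk (hB i)).aemeasurable)]
    congr 1
    ext1 i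
    exact ((indepFun_iff_map_prod_eq_prod_map_map (hA i).aemeasurable
      (hB i).aemeasurable).1 (hAB i)).symm
  rw [h1, Measure.map_map (MeasurableEquiv.measurable _) (by fun_prop)]
  rfl

/-- If every event of `V` is split evenly by the coin `w`, then `w` is a fair coin independent
of `V`. -/
lemma indepFun_bool_of_measure_inter {α : Type*} [MeasurableSpace α] {V : Ω → α} {w : Ω → Bool}
    (hw : Measurable w) (hV : Measurable V)
    (h : ∀ s, MeasurableSet s → P.real (V ⁻¹' s ∩ w ⁻¹' {true}) = P.real (V ⁻¹' s) / 2) :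
    IndepFun V w P ∧ ∀ b, P.real (w ⁻¹' {b}) = 1 / 2 := by
  have hb : ∀ b s, MeasurableSet s → P.real (V ⁻¹' s ∩ w ⁻¹' {b}) = P.real (V ⁻¹' s) / 2 := by
    intro b s hs
    cases b with
    | true => exact h s hs
    | false =>
      have h1 := measureReal_inter_add_sdiff (μ := P) (s := V ⁻¹' s) (hw (measurableSet_singleton true))
      have h2 : V ⁻¹' s \ w ⁻¹' {true} = V ⁻¹' s ∩ w ⁻¹' {false} := by
        ext ω
        simp
      rw [h2, h s hs] at h1
      linarith
  have hhalf : ∀ b, P.real (w ⁻¹' {b}) = 1 / 2 := fun b => by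
    simpa using hb b Set.univ MeasurableSet.univ
  refine ⟨?_, hhalf⟩
  rw [indepFun_iff_measure_inter_preimage_eq_mul]
  classical
  intro s t hs _
  have h3 : ∀ t : Set Bool, w ⁻¹' t = ⋃ b ∈ (Finset.univ.filter (· ∈ t) : Finset Bool),
      w ⁻¹' {b} := by
    intro t
    ext ω
    simp
  have h4 : ∀ A : Set Ω, MeasurableSet A → P.real (A ∩ w ⁻¹' t)
      = ∑ b ∈ (Finset.univ.filter (· ∈ t) : Finset Bool), P.real (A ∩ w ⁻¹' {b}) := by
    intro A hA
    rw [h3 t, Set.inter_iUnion₂]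
    refine measureReal_biUnion_finset (fun b _ c _ hbc => ?_)
      fun b _ => hA.inter (hw (measurableSet_singleton b))
    refine Set.disjoint_left.2 fun ω h1 h2 => hbc ?_
    exact h1.2.symm.trans h2.2
  have h5 := h4 (V ⁻¹' s) (hV hs)
  have h6 := h4 Set.univ MeasurableSet.univ
  simp only [Set.univ_inter, hhalf] at h6
  simp only [hb _ s hs] at h5
  rw [← ENNReal.toReal_eq_toReal_iff' (measure_ne_top _ _)
    (ENNReal.mul_ne_top (measure_ne_top _ _) (measure_ne_top _ _)), ENNReal.toReal_mul]
  change P.real _ = P.real _ * P.real _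
  rw [h5, h6, Finset.sum_const, Finset.sum_const]
  simp only [nsmul_eq_mul]
  ring

end Independence

/-! ### Conditioning on an event of the design, by freezing a finite-valued assignment. -/

section Conditioning

variable {Ω : Type*} [MeasurableSpace Ω] {P : Measure Ω} [IsProbabilityMeasure P]

lemma indepFun_cond_of_indepFun {α β : Type*} [MeasurableSpace α] [MeasurableSpace β] {e : Ω → α}
    {U : Ω → β} (hU : Measurable U) (h : IndepFun e U P) {G : Set β} (hG : MeasurableSet G) :
    IndepFun e U P[|U ⁻¹' G] := by
  rw [indepFun_iff_measure_inter_preimage_eq_mul]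
  intro s t hs ht
  by_cases h0 : P (U ⁻¹' G) = 0
  · have hz : P[|U ⁻¹' G] = 0 := cond_eq_zero_of_meas_eq_zero h0
    simp [hz]
  simp only [cond_apply (hU hG)]
  have h1 : P (U ⁻¹' G ∩ (e ⁻¹' s ∩ U ⁻¹' t)) = P (e ⁻¹' s) * P (U ⁻¹' G ∩ U ⁻¹' t) := by
    rw [← Set.preimage_inter, ← h.measure_inter_preimage_eq_mul s (G ∩ t) hs (hG.inter ht)]
    congr 1
    ext ω
    simp only [Set.mem_inter_iff, Set.mem_preimage]
    tauto
  have h2 : P (U ⁻¹' G ∩ e ⁻¹' s) = P (e ⁻¹' s) * P (U ⁻¹' G) := by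
    rw [Set.inter_comm, h.measure_inter_preimage_eq_mul s G hs hG]
  rw [h1, h2, mul_comm (P (e ⁻¹' s)) (P (U ⁻¹' G)), ← mul_assoc (P (U ⁻¹' G))⁻¹ (P (U ⁻¹' G)),
    ENNReal.inv_mul_cancel h0 (measure_ne_top _ _), one_mul]
  ring

lemma map_cond_of_indepFun {α β : Type*} [MeasurableSpace α] [MeasurableSpace β] {e : Ω → α}
    {U : Ω → β} (he : Measurable e) (hU : Measurable U) (h : IndepFun e U P) {G : Set β}
    (hG : MeasurableSet G) (h0 : P (U ⁻¹' G) ≠ 0) : (P[|U ⁻¹' G]).map e = P.map e := by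
  ext s hs
  rw [Measure.map_apply he hs, Measure.map_apply he hs, cond_apply (hU hG), Set.inter_comm,
    h.measure_inter_preimage_eq_mul s G hs hG, mul_comm, mul_assoc,
    ENNReal.mul_inv_cancel h0 (measure_ne_top _ _), mul_one]

variable {D : Type*} [Finite D] [MeasurableSpace D] [MeasurableSingletonClass D] {w : Ω → D}
  {G : Set D}

omit [IsProbabilityMeasure P] in
lemma ae_cond_of_forall (hw : Measurable w) {p : D → Ω → Prop}
    (h : ∀ c ∈ G, ∀ᵐ ω ∂P, p c ω) : ∀ᵐ ω ∂P[|w ⁻¹' G], p (w ω) ω := by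
  have hall : ∀ᵐ ω ∂P, ∀ c, c ∈ G → p c ω := by
    rw [ae_all_iff]
    exact fun c => by
      by_cases hc : c ∈ G
      · filter_upwards [h c hc] with ω hω _ using hω
      · exact ae_of_all _ fun ω h' => absurd h' hc
  filter_upwards [cond_absolutelyContinuous.ae_le hall,
    ae_cond_mem (μ := P) (hw G.toFinite.measurableSet)] with ω h1 h2 using h1 _ h2

lemma integrable_cond {μ : Measure Ω} {f : Ω → ℝ} {s : Set Ω} (hs : μ s ≠ 0)
    (hf : IntegrableOn f s μ) : Integrable f μ[|s] :=
  Integrable.smul_measure hf (ENNReal.inv_ne_top.2 hs)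

omit [IsProbabilityMeasure P] [Finite D] in
lemma integrableOn_fiber (hw : Measurable w) {F : D → Ω → ℝ} {c : D}
    (h : Integrable (F c) P) : IntegrableOn (fun ω => F (w ω) ω) (w ⁻¹' {c}) P :=
  (h.integrableOn (s := w ⁻¹' {c})).congr_fun (fun ω hω => by rw [show w ω = c from hω])
    (hw (measurableSet_singleton c))

omit [IsProbabilityMeasure P] in
-- On the fibre {w = c} the integrand is F c, and restricting P keeps integrability; G is a finite
-- union of fibres. No independence enters.
lemma integrable_cond_of_forall (hw : Measurable w) (h0 : P (w ⁻¹' G) ≠ 0) {F : D → Ω → ℝ}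
    (h : ∀ c ∈ G, Integrable (F c) P) : Integrable (fun ω => F (w ω) ω) P[|w ⁻¹' G] := by
  refine integrable_cond h0 ?_
  have hG : w ⁻¹' G = ⋃ c ∈ G, w ⁻¹' {c} := by
    ext ω
    simp
  rw [hG, integrableOn_finite_biUnion G.toFinite]
  exact fun c hc => integrableOn_fiber hw (h c hc)

/-- By independence the fibre over c contributes P(w = c) a; as a is common to all c in G,
normalization returns a. -/
lemma integral_cond_of_forall {α : Type*} [MeasurableSpace α] {V : Ω → α} (hw : Measurable w)
    (hV : Measurable V) (hVw : IndepFun V w P) (h0 : P (w ⁻¹' G) ≠ 0) {F : D → α → ℝ} {a : ℝ}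
    (hm : ∀ c ∈ G, Measurable (F c)) (h : ∀ c ∈ G, Integrable (fun ω => F c (V ω)) P)
    (ha : ∀ c ∈ G, ∫ ω, F c (V ω) ∂P = a) :
    ∫ ω, F (w ω) (V ω) ∂P[|w ⁻¹' G] = a := by
  have := Fintype.ofFinite D
  classical
  have hG : w ⁻¹' G = ⋃ c ∈ G.toFinset, w ⁻¹' {c} := by
    ext ω
    simp
  have hfib : ∀ c ∈ G, ∫ ω in w ⁻¹' {c}, F (w ω) (V ω) ∂P = P.real (w ⁻¹' {c}) * a := by
    intro c hc
    have hmc : MeasurableSet (w ⁻¹' {c}) := hw (measurableSet_singleton c)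
    rw [setIntegral_congr_fun (g := fun ω => F c (V ω)) hmc
      (fun ω hω => by simp only [show w ω = c from hω]), ← integral_indicator hmc]
    have h1 : ∀ ω, (w ⁻¹' {c}).indicator (fun ω => F c (V ω)) ω
        = F c (V ω) * Set.indicator {c} (fun _ => (1 : ℝ)) (w ω) := fun ω => by
      by_cases hω : w ω = c <;> simp [Set.indicator, hω]
    simp_rw [h1]
    rw [hVw.integral_fun_comp_mul_comp hV.aemeasurable hw.aemeasurable
      (hm c hc).aestronglyMeasurable
      (measurable_const.indicator (measurableSet_singleton c)).aestronglyMeasurable, ha c hc,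
      mul_comm]
    congr 1
    rw [← integral_indicator_one hmc]
    rfl
  have hdisj : Set.Pairwise (G.toFinset : Set D)
      (Function.onFun Disjoint fun c => w ⁻¹' {c}) := fun c _ c' _ hcc' =>
    Set.disjoint_left.2 fun ω h1 h2 => hcc' (h1.symm.trans h2)
  have hsum : ∫ ω in w ⁻¹' G, F (w ω) (V ω) ∂P = P.real (w ⁻¹' G) * a := by
    rw [hG, integral_biUnion_finset _ (fun c _ => hw (measurableSet_singleton c)) hdisj
      (fun c hc => integrableOn_fiber (F := fun c ω => F c (V ω)) hw
        (h c (Set.mem_toFinset.1 hc))),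
      measureReal_biUnion_finset hdisj (fun c _ => hw (measurableSet_singleton c)),
      Finset.sum_mul]
    exact Finset.sum_congr rfl fun c hc => hfib c (Set.mem_toFinset.1 hc)
  rw [ProbabilityTheory.cond, integral_smul_measure, hsum, ENNReal.toReal_inv, smul_eq_mul,
    ← mul_assoc]
  change (P.real (w ⁻¹' G))⁻¹ * P.real (w ⁻¹' G) * a = a
  rw [inv_mul_cancel₀ ((measureReal_ne_zero_iff).2 h0), one_mul]

end Conditioning

/-! ### Moments of linear combinations of noise with independent coefficients. -/

section NoiseSum

variable {Ω : Type*} [MeasurableSpace Ω] {Q : Measure Ω}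
  {ι β : Type*} [MeasurableSpace β] {e : Ω → ι → ℝ} {U : Ω → β}

lemma integral_mul_noise (he : Measurable e) (hU : Measurable U) (h : IndepFun e U Q)
    {g : β → ℝ} (hg : Measurable g) {f : (ι → ℝ) → ℝ} (hf : Measurable f) :
    ∫ ω, g (U ω) * f (e ω) ∂Q = (∫ ω, g (U ω) ∂Q) * ∫ ω, f (e ω) ∂Q :=
  h.symm.integral_fun_comp_mul_comp hU.aemeasurable he.aemeasurable hg.aestronglyMeasurable
    hf.aestronglyMeasurable

lemma integrable_mul_noise (h : IndepFun e U Q)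
    {g : β → ℝ} (hg : Measurable g) {f : (ι → ℝ) → ℝ} (hf : Measurable f)
    (hgi : Integrable (fun ω => g (U ω)) Q) (hfi : Integrable (fun ω => f (e ω)) Q) :
    Integrable (fun ω => g (U ω) * f (e ω)) Q :=
  (h.symm.comp hg hf).integrable_mul hgi hfi

variable [Fintype ι]

/-- A linear combination of noise variables with coefficients independent of the noise. -/
def noiseSum (e : Ω → ι → ℝ) (U : Ω → β) (g : ι → β → ℝ) (ω : Ω) : ℝ := ∑ i, g i (U ω) * e ω i

variable {g g' : ι → β → ℝ} {v : ℝ}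

lemma integrable_noiseSum (h : IndepFun e U Q) (hg : ∀ i, Measurable (g i))
    (hgi : ∀ i, Integrable (fun ω => g i (U ω)) Q) (hei : ∀ i, Integrable (fun ω => e ω i) Q) :
    Integrable (noiseSum e U g) Q :=
  integrable_finsetSum _ fun i _ =>
    integrable_mul_noise h (hg i) (measurable_pi_apply i) (hgi i) (hei i)

lemma integral_noiseSum (he : Measurable e) (hU : Measurable U) (h : IndepFun e U Q)
    (hg : ∀ i, Measurable (g i))
    (hgi : ∀ i, Integrable (fun ω => g i (U ω)) Q) (hei : ∀ i, Integrable (fun ω => e ω i) Q)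
    (he0 : ∀ i, ∫ ω, e ω i ∂Q = 0) : ∫ ω, noiseSum e U g ω ∂Q = 0 := by
  unfold noiseSum
  rw [integral_finsetSum _ fun i _ =>
    integrable_mul_noise h (hg i) (measurable_pi_apply i) (hgi i) (hei i)]
  refine Finset.sum_eq_zero fun i _ => ?_
  rw [integral_mul_noise he hU h (hg i) (measurable_pi_apply i), he0, mul_zero]

omit [MeasurableSpace Ω] [MeasurableSpace β] in
lemma noiseSum_mul_noiseSum (ω : Ω) : noiseSum e U g ω * noiseSum e U g' ω
    = ∑ i, ∑ l, (g i (U ω) * g' l (U ω)) * (e ω i * e ω l) := by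
  rw [noiseSum, noiseSum, Finset.sum_mul_sum]
  exact Finset.sum_congr rfl fun i _ => Finset.sum_congr rfl fun l _ => by ring

/-- The assumption concerns products of coefficients, not their squares: across groups it holds
without square integrable weights. -/
lemma integrable_noiseSum_mul (h : IndepFun e U Q) (hg : ∀ i, Measurable (g i))
    (hg' : ∀ i, Measurable (g' i))
    (hgg : ∀ i l, Integrable (fun ω => g i (U ω) * g' l (U ω)) Q)
    (hee : ∀ i l, Integrable (fun ω => e ω i * e ω l) Q) :
    Integrable (fun ω => noiseSum e U g ω * noiseSum e U g' ω) Q := by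
  simp_rw [noiseSum_mul_noiseSum]
  exact integrable_finsetSum _ fun i _ => integrable_finsetSum _ fun l _ =>
    integrable_mul_noise (g := fun u => g i u * g' l u) (f := fun x => x i * x l) h
      ((hg i).mul (hg' l)) (by fun_prop) (hgg i l) (hee i l)

/-- Independence separates coefficients from noise, and only the diagonal noise moments survive. -/
lemma integral_noiseSum_mul [DecidableEq ι] (he : Measurable e) (hU : Measurable U) (h : IndepFun e U Q)
    (hg : ∀ i, Measurable (g i)) (hg' : ∀ i, Measurable (g' i))
    (hgg : ∀ i l, Integrable (fun ω => g i (U ω) * g' l (U ω)) Q)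
    (hee : ∀ i l, Integrable (fun ω => e ω i * e ω l) Q)
    (hev : ∀ i l, ∫ ω, e ω i * e ω l ∂Q = if i = l then v else 0) :
    ∫ ω, noiseSum e U g ω * noiseSum e U g' ω ∂Q = v * ∫ ω, ∑ i, g i (U ω) * g' i (U ω) ∂Q := by
  simp_rw [noiseSum_mul_noiseSum]
  have hint : ∀ i l, Integrable (fun ω => (g i (U ω) * g' l (U ω)) * (e ω i * e ω l)) Q :=
    fun i l => integrable_mul_noise (g := fun u => g i u * g' l u) (f := fun x => x i * x l) h
      ((hg i).mul (hg' l)) (by fun_prop) (hgg i l) (hee i l)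
  rw [integral_finsetSum _ fun i _ => integrable_finsetSum _ fun l _ => hint i l,
    integral_finsetSum _ fun i _ => hgg i i, Finset.mul_sum]
  refine Finset.sum_congr rfl fun i _ => ?_
  rw [integral_finsetSum _ fun l _ => hint i l, Finset.sum_eq_single i]
  · rw [integral_mul_noise (g := fun u => g i u * g' i u) (f := fun x => x i * x i) he hU h
      ((hg i).mul (hg' i)) (by fun_prop), hev, if_pos rfl, mul_comm]
  · intro l _ hl
    rw [integral_mul_noise (g := fun u => g i u * g' l u) (f := fun x => x i * x l) he hU h
      ((hg i).mul (hg' l)) (by fun_prop), hev, if_neg hl.symm, mul_zero]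
  · simp

end NoiseSum

/-! ### Decomposition of the least squares fit into coefficient and weighted noise. -/

section Algebra

variable {Ω : Type*} {n d : ℕ}

/-- The least squares weights of unit `i` within group `v`, for the treatment assignment `c`. -/
def groupWeights (v : Bool) (j : Fin d) (i : Fin n)
    (u : Fin n → EuclideanSpace ℝ (Fin d) × Bool) : ℝ :=
  if (u i).2 = v then
    Matrix.mulVec (outerSum fun k : {k // (u k).2 = v} => (u k).1)⁻¹ (u i).1.ofLp j
  else 0

lemma gram_eq_outerSum (X : Fin n → Ω → EuclideanSpace ℝ (Fin d)) (W : Fin n → Ω → Bool) (v : Bool)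
    (ω : Ω) : gram X W v ω = outerSum fun k : {k // W k ω = v} => X k ω := by
  rw [gram, outerSum, ← Finset.sum_filter]
  exact Finset.sum_subtype _ (by simp) fun k => Matrix.vecMulVec (X k ω).ofLp (X k ω).ofLp

/-- Within group v the outcome is ⟨β_v, X_i⟩ + ε_i, so the right-hand side of the normal equations
is G β_v plus a noise term. -/
lemma ols_eq_add_noiseSum {β : Bool → EuclideanSpace ℝ (Fin d)}
    {X : Fin n → Ω → EuclideanSpace ℝ (Fin d)} {W : Fin n → Ω → Bool} {ε : Fin n → Ω → ℝ}
    {v : Bool} {ω : Ω} (h : IsUnit (gram X W v ω)) (j : Fin d) :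
    ols X W (observedOutcome β X W ε) v ω j
      = β v j + noiseSum (fun ω i => ε i ω) (fun ω i => (X i ω, W i ω)) (groupWeights v j) ω := by
  have hsum : (∑ i, if W i ω = v then observedOutcome β X W ε i ω • (X i ω).ofLp else 0)
      = Matrix.mulVec (gram X W v ω) (β v).ofLp
        + ∑ i, if W i ω = v then ε i ω • (X i ω).ofLp else 0 := by
    rw [gram, Matrix.sum_mulVec, ← Finset.sum_add_distrib]
    refine Finset.sum_congr rfl fun i _ => ?_
    by_cases hi : W i ω = v
    · simp only [observedOutcome, potentialOutcome, hi, add_smul, ↓reduceIte]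
      congr 1
      rw [Matrix.vecMulVec_mulVec, EuclideanSpace.inner_eq_star_dotProduct]
      simp
    · simp [hi]
  rw [ols, hsum, Matrix.mulVec_add, Matrix.mulVec_mulVec,
    Matrix.nonsing_inv_mul _ ((Matrix.isUnit_iff_isUnit_det _).1 h), Matrix.one_mulVec,
    Pi.add_apply]
  congr 1
  rw [Matrix.mulVec_sum, Finset.sum_apply, noiseSum]
  refine Finset.sum_congr rfl fun i _ => ?_
  by_cases hi : W i ω = v
  · simp only [groupWeights, if_pos hi, Matrix.mulVec_smul, Pi.smul_apply, smul_eq_mul,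
      gram_eq_outerSum]
    rw [mul_comm]
  · simp [groupWeights, hi]

/-- No unit lies in both groups: this is why the two fits are uncorrelated. -/
lemma groupWeights_mul_of_ne {v v' : Bool} (h : v ≠ v') (j k : Fin d) (i : Fin n)
    (u : Fin n → EuclideanSpace ℝ (Fin d) × Bool) :
    groupWeights v j i u * groupWeights v' k i u = 0 := by
  by_cases h1 : (u i).2 = v
  · rw [groupWeights.eq_def v', if_neg (fun h2 => h (h1.symm.trans h2)), mul_zero]
  · rw [groupWeights, if_neg h1, zero_mul]

lemma sum_groupWeights_mul {v : Bool} {u : Fin n → EuclideanSpace ℝ (Fin d) × Bool}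
    (hu : IsUnit (outerSum fun k : {k // (u k).2 = v} => (u k).1)) (j k : Fin d) :
    ∑ i, groupWeights v j i u * groupWeights v k i u
      = (outerSum fun k : {k // (u k).2 = v} => (u k).1)⁻¹ j k := by
  rw [← sum_weights_mul_weights hu]
  refine Eq.trans ?_ (Finset.sum_subtype (Finset.univ.filter fun i => (u i).2 = v) (by simp)
    fun i => Matrix.mulVec (outerSum fun k : {k // (u k).2 = v} => (u k).1)⁻¹ (u i).1.ofLp j
      * Matrix.mulVec (outerSum fun k : {k // (u k).2 = v} => (u k).1)⁻¹ (u i).1.ofLp k)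
  rw [Finset.sum_filter]
  refine Finset.sum_congr rfl fun i _ => ?_
  by_cases hi : (u i).2 = v <;> simp [groupWeights, hi]

/-- The index type of the sum depends on the assignment; freezing one of its finitely many values
removes the dependence. -/
lemma measurable_groupWeights (v : Bool) (j : Fin d) (i : Fin n) :
    Measurable (groupWeights v j i : (Fin n → EuclideanSpace ℝ (Fin d) × Bool) → ℝ) := by
  have h : Measurable fun p : (Fin n → EuclideanSpace ℝ (Fin d)) × (Fin n → Bool) =>
      groupWeights v j i fun k => (p.1 k, p.2 k) := by
    refine measurable_from_prod_countable_left fun c => ?_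
    by_cases hc : c i = v
    · simp only [groupWeights, if_pos hc]
      exact measurable_weights
        (x := fun (x : Fin n → EuclideanSpace ℝ (Fin d)) (k : {k // c k = v}) => x k)
        (fun k => measurable_pi_apply _) ⟨i, hc⟩ j
    · simp only [groupWeights, if_neg hc]
      exact measurable_const
  exact h.comp (f := fun u : Fin n → EuclideanSpace ℝ (Fin d) × Bool =>
    ((fun k => (u k).1, fun k => (u k).2) :
      (Fin n → EuclideanSpace ℝ (Fin d)) × (Fin n → Bool))) (by fun_prop)

end Algebra

/-! ### Symmetry of the Gaussian and of the logistic function. -/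

section Symmetry

variable {d : ℕ}

lemma map_neg_multivariateGaussian (S : Matrix (Fin d) (Fin d) ℝ) :
    (multivariateGaussian 0 S).map (fun x => -x) = multivariateGaussian 0 S := by
  rw [multivariateGaussian]
  conv_rhs => rw [← map_neg_stdGaussian]
  rw [Measure.map_map (by fun_prop) (by fun_prop), Measure.map_map (by fun_prop) (by fun_prop)]
  congr 1
  ext1 x
  simp

/-- The map x ↦ -x preserves N and B and turns the sigmoid into one minus it, so the integral I
satisfies I = N(B) - I. -/
lemma setIntegral_sigmoid_inner {N : Measure (EuclideanSpace ℝ (Fin d))} [IsProbabilityMeasure N]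
    (hN : N.map (fun x => -x) = N) (η : EuclideanSpace ℝ (Fin d))
    {B : Set (EuclideanSpace ℝ (Fin d))} (hB : MeasurableSet B) (hsymm : (fun x => -x) ⁻¹' B = B) :
    ∫ x in B, Real.sigmoid (inner ℝ η x) ∂N = N.real B / 2 := by
  have hcont : Continuous fun x : EuclideanSpace ℝ (Fin d) => Real.sigmoid (inner ℝ η x) :=
    continuous_sigmoid.comp (by fun_prop)
  have hint : Integrable (fun x => Real.sigmoid (inner ℝ η x)) N := by
    refine Integrable.of_bound hcont.aestronglyMeasurable 1 (ae_of_all _ fun x => ?_)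
    rw [Real.norm_of_nonneg (Real.sigmoid_nonneg _)]
    exact Real.sigmoid_le_one _
  have h1 : ∫ x in B, Real.sigmoid (inner ℝ η x) ∂N
      = ∫ x in B, (1 - Real.sigmoid (inner ℝ η x)) ∂N := by
    conv_lhs => rw [← hN]
    rw [setIntegral_map hB hcont.aestronglyMeasurable (by fun_prop), hsymm]
    simp_rw [inner_neg_right, Real.sigmoid_neg]
  rw [integral_sub (integrable_const _) hint.integrableOn, setIntegral_const, smul_eq_mul,
    mul_one] at h1
  linarith

end Symmetry

/-! ### Consequences of the model for a frozen assignment, and the fair coin. -/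

namespace IsModel

variable {Ω : Type*} [MeasurableSpace Ω] {P : Measure Ω} {n d : ℕ}
  {S : Matrix (Fin d) (Fin d) ℝ} {η : EuclideanSpace ℝ (Fin d)} {σ : ℝ}
  {X : Fin n → Ω → EuclideanSpace ℝ (Fin d)} {W : Fin n → Ω → Bool} {ε : Fin n → Ω → ℝ}

lemma indep_X (hM : IsModel P S η σ X W ε) : iIndepFun X P :=
  hM.indep.comp (fun _ => Prod.fst) fun _ => measurable_fst

lemma indep_W (hM : IsModel P S η σ X W ε) : iIndepFun W P :=
  hM.indep.comp (fun _ p => p.2.1) fun _ => by fun_prop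

lemma iIndepFun_noise (hM : IsModel P S η σ X W ε) : iIndepFun ε P :=
  hM.indep.comp (fun _ p => p.2.2) fun _ => by fun_prop

lemma measurable_noise_family (hM : IsModel P S η σ X W ε) : Measurable fun ω i => ε i ω :=
  measurable_pi_lambda _ hM.measurable_noise

lemma measurable_assignment (hM : IsModel P S η σ X W ε) : Measurable fun ω i => W i ω :=
  measurable_pi_lambda _ hM.measurable_W

lemma measurable_design (hM : IsModel P S η σ X W ε) : Measurable fun ω i => (X i ω, W i ω) :=
  measurable_pi_lambda _ fun i => (hM.measurable_X i).prodMk (hM.measurable_W i)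

lemma integrable_noise_mul (hM : IsModel P S η σ X W ε) (i l : Fin n) :
    Integrable (fun ω => ε i ω * ε l ω) P :=
  (hM.memLp_noise i).integrable_mul (hM.memLp_noise l)

lemma integral_noise_mul (hM : IsModel P S η σ X W ε) (i l : Fin n) :
    ∫ ω, ε i ω * ε l ω ∂P = if i = l then σ ^ 2 else 0 := by
  by_cases h : i = l
  · subst h
    rw [if_pos rfl, ← hM.variance_noise i,
      variance_of_integral_eq_zero (hM.measurable_noise i).aemeasurable (hM.mean_noise i)]
    simp [sq]
  · rw [if_neg h, (hM.iIndepFun_noise.indepFun h).integral_fun_mul_eq_mul_integral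
      (hM.measurable_noise i).aestronglyMeasurable (hM.measurable_noise l).aestronglyMeasurable,
      hM.mean_noise i, zero_mul]

lemma indepFun_groups (hM : IsModel P S η σ X W ε) (c : Fin n → Bool) :
    IndepFun (fun ω (k : {k // c k = true}) => X k ω) (fun ω (k : {k // c k = false}) => X k ω)
      P := by
  have h := hM.indep_X.indepFun_finset (Finset.univ.filter fun k => c k = true)
    (Finset.univ.filter fun k => c k = false)
    (Finset.disjoint_filter.2 fun k _ h1 h2 => by simp [h1] at h2) hM.measurable_X
  exact h.comp
    (φ := fun (y : (Finset.univ.filter fun k => c k = true) → EuclideanSpace ℝ (Fin d))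
      (k : {k // c k = true}) => y ⟨k, by simp [k.2]⟩)
    (ψ := fun (y : (Finset.univ.filter fun k => c k = false) → EuclideanSpace ℝ (Fin d))
      (k : {k // c k = false}) => y ⟨k, by simp [k.2]⟩) (by fun_prop) (by fun_prop)

lemma measurePreserving_group (hM : IsModel P S η σ X W ε) (c : Fin n → Bool) (v : Bool) :
    MeasurePreserving (fun ω (k : {k // c k = v}) => X k ω) P
      (Measure.pi fun _ => multivariateGaussian 0 S) := by
  have hX := hM.measurable_X
  refine ⟨by fun_prop, ?_⟩
  have hind : iIndepFun (fun k : {k // c k = v} => X k) P :=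
    hM.indep_X.precomp Subtype.val_injective
  have h := iIndepFun.map_fun_eq_pi_map (f := fun k : {k // c k = v} => X k)
    (fun k => (hX k).aemeasurable) hind
  simp_rw [hM.gaussian] at h
  exact h

lemma ae_isUnit_group (hM : IsModel P S η σ X W ε) (hS : S.PosDef) (c : Fin n → Bool) (v : Bool)
    (h : d ≤ Fintype.card {k // c k = v}) :
    ∀ᵐ ω ∂P, IsUnit (outerSum fun k : {k // c k = v} => X k ω) :=
  (hM.measurePreserving_group c v).quasiMeasurePreserving.ae
    (ae_isUnit_outerSum hS (by simpa using h))

lemma integrable_groupWeights (hM : IsModel P S η σ X W ε) (hS : S.PosDef) (c : Fin n → Bool)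
    (v : Bool) (h : d < Fintype.card {k // c k = v}) (j : Fin d) (i : Fin n) :
    Integrable (fun ω => groupWeights v j i fun k => (X k ω, c k)) P := by
  by_cases hi : c i = v
  · simp only [groupWeights, if_pos hi]
    exact (hM.measurePreserving_group c v).integrable_comp_of_integrable
      (integrable_weights hS (by simpa using h) ⟨i, hi⟩ j)
  · simp [groupWeights, hi]

lemma memLp_groupWeights (hM : IsModel P S η σ X W ε) (hS : S.PosDef) (c : Fin n → Bool)
    (v : Bool) (h : d + 1 < Fintype.card {k // c k = v}) (j : Fin d) (i : Fin n) :
    MemLp (fun ω => groupWeights v j i fun k => (X k ω, c k)) 2 P := by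
  by_cases hi : c i = v
  · simp only [groupWeights, if_pos hi]
    exact (memLp_weights hS (by simpa using h) ⟨i, hi⟩ j).comp_measurePreserving
      (hM.measurePreserving_group c v)
  · simp [groupWeights, hi]

/-- For frozen c the weights of the two groups are functions of independent covariates, so first
moments suffice for the product. -/
lemma integrable_groupWeights_mul (hM : IsModel P S η σ X W ε) (hS : S.PosDef)
    (c : Fin n → Bool) (h : ∀ v, d < Fintype.card {k // c k = v}) (j j' : Fin d) (i l : Fin n) :
    Integrable (fun ω => groupWeights true j i (fun k => (X k ω, c k))
      * groupWeights false j' l (fun k => (X k ω, c k))) P := by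
  by_cases hi : c i = true
  · by_cases hl : c l = false
    · have h1 := hM.integrable_groupWeights hS c true (h true) j i
      have h2 := hM.integrable_groupWeights hS c false (h false) j' l
      simp only [groupWeights, if_pos hi, if_pos hl] at h1 h2 ⊢
      exact ((hM.indepFun_groups c).comp
        (measurable_weights (x := fun y : {k // c k = true} → EuclideanSpace ℝ (Fin d) => y)
          (fun k => measurable_pi_apply _) ⟨i, hi⟩ j)
        (measurable_weights (x := fun y : {k // c k = false} → EuclideanSpace ℝ (Fin d) => y)
          (fun k => measurable_pi_apply _) ⟨l, hl⟩ j')).integrable_mul h1 h2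
    · simp [groupWeights, hl]
  · simp [groupWeights, hi]

lemma integrable_group_inv (hM : IsModel P S η σ X W ε) (c : Fin n → Bool)
    (v : Bool) (h : d + 1 < Fintype.card {k // c k = v}) (j j' : Fin d) :
    Integrable (fun ω => (outerSum fun k : {k // c k = v} => X k ω)⁻¹ j j') P :=
  (hM.measurePreserving_group c v).integrable_comp_of_integrable
    (integrable_outerSum_inv (by simpa using h) j j')

lemma integral_group_inv (hM : IsModel P S η σ X W ε) (hS : S.PosDef) (c : Fin n → Bool)
    (v : Bool) (h : d + 1 < Fintype.card {k // c k = v}) (j j' : Fin d) :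
    ∫ ω, (outerSum fun k : {k // c k = v} => X k ω)⁻¹ j j' ∂P
      = ((Fintype.card {k // c k = v} : ℝ) - d - 1)⁻¹ * S⁻¹ j j' := by
  have hmp := hM.measurePreserving_group c v
  have h1 := integral_outerSum_inv (ι := {k // c k = v}) hS (by simpa using h) j j'
  rw [← hmp.map_eq, integral_map hmp.measurable.aemeasurable
    (measurable_outerSum_inv_apply (fun i => measurable_pi_apply i) j j').aestronglyMeasurable]
    at h1
  simpa using h1

variable [IsProbabilityMeasure P]

lemma indepFun_noise_design (hM : IsModel P S η σ X W ε) :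
    IndepFun (fun ω i => ε i ω) (fun ω i => (X i ω, W i ω)) P :=
  indepFun_families hM.measurable_noise
    (fun i => (hM.measurable_X i).prodMk (hM.measurable_W i))
    (hM.indep.comp (fun _ p => (p.2.2, (p.1, p.2.1))) fun _ => by fun_prop) hM.indep_noise

/-- Events of X Xᵀ are events {X ∈ B} with B = -B, and the propensity averages to one half over each
such B. Independence of X itself from W is not claimed. -/
lemma fair_coin (hM : IsModel P S η σ X W ε) (i : Fin n) :
    IndepFun (fun ω j k => X i ω j * X i ω k) (W i) P ∧ ∀ b, P.real (W i ⁻¹' {b}) = 1 / 2 := by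
  have hX := hM.measurable_X i
  have hout : Measurable fun (x : EuclideanSpace ℝ (Fin d)) j k => x j * x k := by fun_prop
  refine indepFun_bool_of_measure_inter (hM.measurable_W i) (hout.comp hX) fun s hs => ?_
  set B : Set (EuclideanSpace ℝ (Fin d)) := (fun x j k => x j * x k) ⁻¹' s with hBdef
  have hB : MeasurableSet B := hout hs
  have hsymm : (fun x => -x) ⁻¹' B = B := by
    rw [hBdef, ← Set.preimage_comp]
    congr 1
    ext x j k
    simp
  change P.real (X i ⁻¹' B ∩ W i ⁻¹' {true}) = P.real (X i ⁻¹' B) / 2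
  have hWt : MeasurableSet (W i ⁻¹' {true}) := hM.measurable_W i (measurableSet_singleton _)
  have h1 := setIntegral_condExp (μ := P) hX.comap_le
    (f := (W i ⁻¹' {true}).indicator fun _ => (1 : ℝ))
    ((integrable_const 1).indicator hWt) (s := X i ⁻¹' B) ⟨B, hB, rfl⟩
  rw [setIntegral_congr_ae (hX hB) ((hM.propensity i).mono fun ω h _ => h)] at h1
  have h2 : ∫ ω in X i ⁻¹' B, Real.sigmoid (inner ℝ η (X i ω)) ∂P
      = ∫ x in B, Real.sigmoid (inner ℝ η x) ∂(P.map (X i)) :=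
    (setIntegral_map hB (continuous_sigmoid.comp (by fun_prop)).aestronglyMeasurable
      hX.aemeasurable).symm
  have h3 : ∫ ω in X i ⁻¹' B, (W i ⁻¹' {true}).indicator (fun _ => (1 : ℝ)) ω ∂P
      = P.real (X i ⁻¹' B ∩ W i ⁻¹' {true}) := by
    rw [setIntegral_indicator hWt, setIntegral_const, smul_eq_mul, mul_one]
  rw [← h3, ← h1, h2, hM.gaussian i,
    setIntegral_sigmoid_inner (map_neg_multivariateGaussian S) η hB hsymm, ← hM.gaussian i,
    map_measureReal_apply hX hB]

lemma indepFun_outer_assignment (hM : IsModel P S η σ X W ε) :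
    IndepFun (fun ω i j k => X i ω j * X i ω k) (fun ω i => W i ω) P := by
  refine indepFun_families (A := fun i ω j k => X i ω j * X i ω k) (fun i => ?_) hM.measurable_W
    (hM.indep.comp (fun _ p => (fun j k => p.1 j * p.1 k, p.2.1)) fun _ => by fun_prop)
    fun i => (hM.fair_coin i).1
  have := hM.measurable_X i
  fun_prop

lemma measure_assignment_ne_zero (hM : IsModel P S η σ X W ε) (c : Fin n → Bool) :
    P ((fun ω i => W i ω) ⁻¹' {c}) ≠ 0 := by
  have h := hM.indep_W.measure_inter_preimage_eq_mul Finset.univ (sets := fun i => {c i})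
    fun i _ => measurableSet_singleton _
  have heq : (fun ω i => W i ω) ⁻¹' {c} = ⋂ i ∈ Finset.univ, W i ⁻¹' {c i} := by
    ext ω
    simp [funext_iff]
  rw [heq, h, Finset.prod_ne_zero_iff]
  intro i _ h0
  have := (hM.fair_coin i).2 (c i)
  rw [measureReal_def, h0] at this
  norm_num at this

end IsModel

/-! ### Assignments with a given group size. -/

section Counting

variable {n : ℕ}

/-- The treatment assignments in which exactly `m` units have status `w`. -/
def assignments (n : ℕ) (w : Bool) (m : ℕ) : Set (Fin n → Bool) :=
  {c | Fintype.card {k // c k = w} = m}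

lemma setOf_groupSize_eq {Ω : Type*} (W : Fin n → Ω → Bool) (w : Bool) (m : ℕ) :
    {ω | groupSize W w ω = m} = (fun ω i => W i ω) ⁻¹' assignments n w m := by
  ext ω
  change groupSize W w ω = m ↔ Fintype.card {k // W k ω = w} = m
  rw [Fintype.card_subtype, groupSize]

lemma card_fiber_not (c : Fin n → Bool) (w : Bool) :
    Fintype.card {k // c k = w} + Fintype.card {k // c k = !w} = n := by
  have h := Fintype.card_subtype_compl fun k => c k = w
  have h2 := Fintype.card_subtype_le fun k => c k = w
  have h3 : Fintype.card {k // c k = !w} = Fintype.card {k // ¬ c k = w} :=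
    Fintype.card_congr (Equiv.subtypeEquivRight fun k => by cases c k <;> cases w <;> simp)
  rw [Fintype.card_fin] at h h2
  omega

lemma assignments_nonempty (w : Bool) {m : ℕ} (h : m ≤ n) : (assignments n w m).Nonempty := by
  obtain ⟨T, -, hT⟩ := Finset.exists_subset_card_eq (s := (Finset.univ : Finset (Fin n)))
    (n := m) (by simpa using h)
  refine ⟨fun i => if i ∈ T then w else !w, ?_⟩
  change Fintype.card _ = m
  rw [Fintype.card_subtype, ← hT]
  congr 1
  ext i
  by_cases hi : i ∈ T <;> simp [hi]

lemma lt_card_fiber {c : Fin n → Bool} {w : Bool} {m d : ℕ} (hc : c ∈ assignments n w m)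
    (h1 : d < m) (h2 : d + m < n) (v : Bool) : d < Fintype.card {k // c k = v} := by
  have hw : Fintype.card {k // c k = w} = m := hc
  have hn := card_fiber_not c w
  by_cases hv : v = w
  · subst hv
    omega
  · have hv' : v = !w := by cases v <;> cases w <;> simp_all
    subst hv'
    omega

end Counting

lemma integral_of_ae_eq_const_add {Ω : Type*} [MeasurableSpace Ω] {Q : Measure Ω}
    [IsProbabilityMeasure Q] {R U : Ω → ℝ} {b : ℝ} (hU : U =ᵐ[Q] fun ω => b + R ω)
    (hR : Integrable R Q) (h0 : ∫ ω, R ω ∂Q = 0) : ∫ ω, U ω ∂Q = b := by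
  rw [integral_congr_ae hU, integral_add (integrable_const b) hR, h0]
  simp

/-- Covariance is by definition the integral of the centred product, so integrability of R and R' is
enough to identify the means. -/
lemma covariance_of_ae_eq_const_add {Ω : Type*} [MeasurableSpace Ω] {Q : Measure Ω}
    [IsProbabilityMeasure Q] {R R' U U' : Ω → ℝ} {b b' : ℝ} (hU : U =ᵐ[Q] fun ω => b + R ω)
    (hU' : U' =ᵐ[Q] fun ω => b' + R' ω) (hR : Integrable R Q) (hR' : Integrable R' Q)
    (h0 : ∫ ω, R ω ∂Q = 0) (h0' : ∫ ω, R' ω ∂Q = 0) :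
    covariance U U' Q = ∫ ω, R ω * R' ω ∂Q := by
  rw [covariance, integral_of_ae_eq_const_add hU hR h0, integral_of_ae_eq_const_add hU' hR' h0']
  refine integral_congr_ae ?_
  filter_upwards [hU, hU'] with ω h h'
  rw [h, h']
  ring

/-! ### Moments conditional on a group size. -/

namespace IsModel

variable {Ω : Type*} [MeasurableSpace Ω] {P : Measure Ω} [IsProbabilityMeasure P] {n d : ℕ}
  {S : Matrix (Fin d) (Fin d) ℝ} {η : EuclideanSpace ℝ (Fin d)} {σ : ℝ}
  {X : Fin n → Ω → EuclideanSpace ℝ (Fin d)} {W : Fin n → Ω → Bool} {ε : Fin n → Ω → ℝ}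
  {w : Bool} {m : ℕ}

lemma measure_groupSize_ne_zero (hM : IsModel P S η σ X W ε) (h : m ≤ n) :
    P ((fun ω i => W i ω) ⁻¹' assignments n w m) ≠ 0 := by
  obtain ⟨c, hc⟩ := assignments_nonempty w h
  exact fun h0 => hM.measure_assignment_ne_zero c
    (measure_mono_null (Set.preimage_mono (Set.singleton_subset_iff.2 hc)) h0)

omit [IsProbabilityMeasure P] in
lemma condGroupSize_eq : condGroupSize P W w m
    = P[|(fun ω i => W i ω) ⁻¹' assignments n w m] := by
  rw [condGroupSize, setOf_groupSize_eq]

lemma isProbabilityMeasure_condGroupSize (hM : IsModel P S η σ X W ε) (h : m ≤ n) :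
    IsProbabilityMeasure (condGroupSize P W w m) := by
  rw [condGroupSize_eq]
  exact cond_isProbabilityMeasure (hM.measure_groupSize_ne_zero h)

lemma indepFun_condGroupSize (hM : IsModel P S η σ X W ε) :
    IndepFun (fun ω i => ε i ω) (fun ω i => (X i ω, W i ω)) (condGroupSize P W w m) := by
  rw [condGroupSize_eq]
  exact indepFun_cond_of_indepFun hM.measurable_design hM.indepFun_noise_design
    (G := (fun u i => (u i).2) ⁻¹' assignments n w m)
    ((show Measurable fun (u : Fin n → EuclideanSpace ℝ (Fin d) × Bool) i => (u i).2 by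
      fun_prop) (Set.toFinite _).measurableSet)

lemma measurePreserving_noise (hM : IsModel P S η σ X W ε) (h : m ≤ n) :
    MeasurePreserving (fun ω i => ε i ω) (condGroupSize P W w m)
      (P.map fun ω i => ε i ω) := by
  refine ⟨hM.measurable_noise_family, ?_⟩
  rw [condGroupSize_eq]
  exact map_cond_of_indepFun hM.measurable_noise_family hM.measurable_design
    hM.indepFun_noise_design (G := (fun u i => (u i).2) ⁻¹' assignments n w m)
    ((show Measurable fun (u : Fin n → EuclideanSpace ℝ (Fin d) × Bool) i => (u i).2 by
      fun_prop) (Set.toFinite _).measurableSet)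
    (hM.measure_groupSize_ne_zero h)

lemma integral_cond_noise (hM : IsModel P S η σ X W ε) (h : m ≤ n) {f : (Fin n → ℝ) → ℝ}
    (hf : Measurable f) :
    ∫ ω, f (fun i => ε i ω) ∂(condGroupSize P W w m) = ∫ ω, f (fun i => ε i ω) ∂P := by
  have h1 := integral_map (hM.measurePreserving_noise (w := w) h).measurable.aemeasurable
    (μ := condGroupSize P W w m) hf.aestronglyMeasurable
  rw [← h1, (hM.measurePreserving_noise h).map_eq,
    integral_map hM.measurable_noise_family.aemeasurable hf.aestronglyMeasurable]

lemma integrable_cond_noise (hM : IsModel P S η σ X W ε) (h : m ≤ n) {f : (Fin n → ℝ) → ℝ}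
    (hf : Measurable f) (hint : Integrable (fun ω => f fun i => ε i ω) P) :
    Integrable (fun ω => f fun i => ε i ω) (condGroupSize P W w m) :=
  (hM.measurePreserving_noise h).integrable_comp_of_integrable
    ((integrable_map_measure hf.aestronglyMeasurable
      hM.measurable_noise_family.aemeasurable).2 hint)

omit [IsProbabilityMeasure P] in
lemma ae_isUnit_gram (hM : IsModel P S η σ X W ε) (hS : S.PosDef) (v : Bool)
    (h : ∀ c ∈ assignments n w m, d ≤ Fintype.card {k // c k = v}) :
    ∀ᵐ ω ∂(condGroupSize P W w m), IsUnit (gram X W v ω) := by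
  simp_rw [condGroupSize_eq, gram_eq_outerSum]
  exact ae_cond_of_forall (p := fun c ω => IsUnit (outerSum fun k : {k // c k = v} => X k ω))
    hM.measurable_assignment fun c hc => hM.ae_isUnit_group hS c v (h c hc)

omit [IsProbabilityMeasure P] in
lemma ols_ae_eq (hM : IsModel P S η σ X W ε) (hS : S.PosDef)
    (β : Bool → EuclideanSpace ℝ (Fin d)) (v : Bool)
    (h : ∀ c ∈ assignments n w m, d ≤ Fintype.card {k // c k = v}) (j : Fin d) :
    (fun ω => ols X W (observedOutcome β X W ε) v ω j) =ᵐ[condGroupSize P W w m] fun ω => β v j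
      + noiseSum (fun ω i => ε i ω) (fun ω i => (X i ω, W i ω)) (groupWeights v j) ω :=
  (hM.ae_isUnit_gram hS v h).mono fun _ hω => ols_eq_add_noiseSum hω j

lemma integrable_cond_groupWeights (hM : IsModel P S η σ X W ε) (hS : S.PosDef) (hm : m ≤ n)
    (v : Bool) (h : ∀ c ∈ assignments n w m, d < Fintype.card {k // c k = v}) (j : Fin d)
    (i : Fin n) :
    Integrable (fun ω => groupWeights v j i fun k => (X k ω, W k ω)) (condGroupSize P W w m) := by
  rw [condGroupSize_eq]
  exact integrable_cond_of_forall (F := fun c ω => groupWeights v j i fun k => (X k ω, c k))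
    hM.measurable_assignment (hM.measure_groupSize_ne_zero hm)
    fun c hc => hM.integrable_groupWeights hS c v (h c hc) j i

lemma integrable_cond_groupWeights_mul (hM : IsModel P S η σ X W ε) (hS : S.PosDef) (hm : m ≤ n)
    (h : ∀ c ∈ assignments n w m, ∀ v, d < Fintype.card {k // c k = v}) (j j' : Fin d)
    (i l : Fin n) :
    Integrable (fun ω => groupWeights true j i (fun k => (X k ω, W k ω))
      * groupWeights false j' l (fun k => (X k ω, W k ω))) (condGroupSize P W w m) := by
  rw [condGroupSize_eq]
  exact integrable_cond_of_forall (F := fun c ω => groupWeights true j i (fun k => (X k ω, c k))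
      * groupWeights false j' l (fun k => (X k ω, c k)))
    hM.measurable_assignment (hM.measure_groupSize_ne_zero hm)
    fun c hc => hM.integrable_groupWeights_mul hS c (h c hc) j j' i l

lemma integrable_cond_groupWeights_mul_self (hM : IsModel P S η σ X W ε) (hS : S.PosDef)
    (hm : m ≤ n) (v : Bool) (h : ∀ c ∈ assignments n w m, d + 1 < Fintype.card {k // c k = v})
    (j j' : Fin d) (i l : Fin n) :
    Integrable (fun ω => groupWeights v j i (fun k => (X k ω, W k ω))
      * groupWeights v j' l (fun k => (X k ω, W k ω))) (condGroupSize P W w m) := by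
  rw [condGroupSize_eq]
  exact integrable_cond_of_forall (F := fun c ω => groupWeights v j i (fun k => (X k ω, c k))
      * groupWeights v j' l (fun k => (X k ω, c k)))
    hM.measurable_assignment (hM.measure_groupSize_ne_zero hm)
    fun c hc => (hM.memLp_groupWeights hS c v (h c hc) j i).integrable_mul
      (hM.memLp_groupWeights hS c v (h c hc) j' l)

lemma integrable_cond_gram_inv (hM : IsModel P S η σ X W ε) (hm : m ≤ n)
    (v : Bool) (h : ∀ c ∈ assignments n w m, d + 1 < Fintype.card {k // c k = v})
    (j j' : Fin d) :
    Integrable (fun ω => (gram X W v ω)⁻¹ j j') (condGroupSize P W w m) := by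
  simp_rw [condGroupSize_eq, gram_eq_outerSum]
  exact integrable_cond_of_forall
    (F := fun c ω => (outerSum fun k : {k // c k = v} => X k ω)⁻¹ j j')
    hM.measurable_assignment (hM.measure_groupSize_ne_zero hm)
    fun c hc => hM.integrable_group_inv c v (h c hc) j j'

/-- The Gram matrix sees X only through outer products, which are independent of the assignment.
Each assignment of group size m therefore gives the same inverse Wishart mean. -/
lemma integral_cond_gram_inv (hM : IsModel P S η σ X W ε) (hS : S.PosDef) (hm : m ≤ n)
    (h : d + 1 < m) (j j' : Fin d) :
    ∫ ω, (gram X W w ω)⁻¹ j j' ∂(condGroupSize P W w m)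
      = ((m : ℝ) - d - 1)⁻¹ * S⁻¹ j j' := by
  -- Exhibits the inverse as a function of the products X_p X_q alone, the variables known to be
  -- independent of W.
  have houter : ∀ (c : Fin n → Bool) (x : Fin n → EuclideanSpace ℝ (Fin d)),
      (outerSum fun k : {k // c k = w} => x k)⁻¹ j j'
        = (Matrix.of fun p q => ∑ k : {k // c k = w}, x k p * x k q)⁻¹ j j' := fun c x => by
    have hx : (outerSum fun k : {k // c k = w} => x k)
        = Matrix.of fun p q => ∑ k : {k // c k = w}, x k p * x k q := by
      ext p q
      simp [outerSum, Matrix.sum_apply, Matrix.vecMulVec_apply]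
    rw [hx]
  simp_rw [condGroupSize_eq, gram_eq_outerSum]
  have hX := hM.measurable_X
  have hcard : ∀ c ∈ assignments n w m, Fintype.card {k // c k = w} = m := fun c hc => hc
  have key := integral_cond_of_forall (P := P) (G := assignments n w m)
    (V := fun ω i p q => X i ω p * X i ω q) hM.measurable_assignment (by fun_prop)
    hM.indepFun_outer_assignment (hM.measure_groupSize_ne_zero hm)
    (F := fun c y => (Matrix.of fun p q => ∑ k : {k // c k = w}, y k p q)⁻¹ j j')
    (a := ((m : ℝ) - d - 1)⁻¹ * S⁻¹ j j')
    (fun c _ => measurable_inv_apply (fun p q => by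
      simp only [Matrix.of_apply]
      fun_prop) j j')
    (fun c hc => (hM.integrable_group_inv c w (by rw [hcard c hc]; exact h) j j').congr
      (ae_of_all _ fun ω => houter c fun i => X i ω))
    (fun c hc => by
      have := hM.integral_group_inv hS c w (by rw [hcard c hc]; exact h) j j'
      rw [hcard c hc] at this
      exact (integral_congr_ae (ae_of_all _ fun ω => (houter c fun i => X i ω).symm)).trans this)
  rw [← key]
  exact integral_congr_ae (ae_of_all _ fun ω => houter (fun i => W i ω) fun i => X i ω)

lemma memLp_noiseSum (hM : IsModel P S η σ X W ε) (hS : S.PosDef) (hm : m ≤ n) (v : Bool)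
    (h : ∀ c ∈ assignments n w m, d + 1 < Fintype.card {k // c k = v}) (j : Fin d) :
    MemLp (noiseSum (fun ω i => ε i ω) (fun ω i => (X i ω, W i ω)) (groupWeights v j)) 2
      (condGroupSize P W w m) := by
  have hi := integrable_noiseSum (hM.indepFun_condGroupSize (w := w) (m := m))
    (fun i => measurable_groupWeights v j i)
    (fun i => hM.integrable_cond_groupWeights hS hm v (fun c hc => by have := h c hc; omega) j i)
    (fun i => hM.integrable_cond_noise hm (f := fun x => x i) (measurable_pi_apply i)
      ((hM.memLp_noise i).integrable (by norm_num)))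
  rw [memLp_two_iff_integrable_sq hi.aestronglyMeasurable]
  simp_rw [sq]
  exact integrable_noiseSum_mul hM.indepFun_condGroupSize
    (fun i => measurable_groupWeights v j i) (fun i => measurable_groupWeights v j i)
    (fun i l => hM.integrable_cond_groupWeights_mul_self hS hm v h j j i l)
    (fun i l => hM.integrable_cond_noise hm (f := fun x => x i * x l) (by fun_prop)
      (hM.integrable_noise_mul i l))

/-- The two least squares fits, conditionally on a group size: integrability of coordinates and
products, and the covariances in terms of the least squares weights. -/
lemma covariance_ols (hM : IsModel P S η σ X W ε) (hS : S.PosDef)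
    (β : Bool → EuclideanSpace ℝ (Fin d)) (hm : m ≤ n) (v v' : Bool) (j j' : Fin d)
    (h : ∀ c ∈ assignments n w m, d < Fintype.card {k // c k = v})
    (h' : ∀ c ∈ assignments n w m, d < Fintype.card {k // c k = v'})
    (hint : ∀ i l, Integrable (fun ω => groupWeights v j i (fun k => (X k ω, W k ω))
      * groupWeights v' j' l (fun k => (X k ω, W k ω))) (condGroupSize P W w m)) :
    Integrable (fun ω => ols X W (observedOutcome β X W ε) v ω j) (condGroupSize P W w m) ∧
    Integrable (fun ω => ols X W (observedOutcome β X W ε) v ω j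
      * ols X W (observedOutcome β X W ε) v' ω j') (condGroupSize P W w m) ∧
    covariance (fun ω => ols X W (observedOutcome β X W ε) v ω j)
        (fun ω => ols X W (observedOutcome β X W ε) v' ω j') (condGroupSize P W w m)
      = σ ^ 2 * ∫ ω, ∑ i, groupWeights v j i (fun k => (X k ω, W k ω))
          * groupWeights v' j' i (fun k => (X k ω, W k ω)) ∂(condGroupSize P W w m) := by
  have := hM.isProbabilityMeasure_condGroupSize (w := w) hm
  have hind := hM.indepFun_condGroupSize (w := w) (m := m)
  have hei : ∀ i, Integrable (fun ω => ε i ω) (condGroupSize P W w m) := fun i =>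
    hM.integrable_cond_noise hm (f := fun x => x i) (measurable_pi_apply i)
      ((hM.memLp_noise i).integrable (by norm_num))
  have he0 : ∀ i, ∫ ω, ε i ω ∂(condGroupSize P W w m) = 0 := fun i =>
    (hM.integral_cond_noise hm (f := fun x => x i) (measurable_pi_apply i)).trans (hM.mean_noise i)
  have hee : ∀ i l, Integrable (fun ω => ε i ω * ε l ω) (condGroupSize P W w m) := fun i l =>
    hM.integrable_cond_noise hm (f := fun x => x i * x l) (by fun_prop)
      (hM.integrable_noise_mul i l)
  have hev : ∀ i l, ∫ ω, ε i ω * ε l ω ∂(condGroupSize P W w m) = if i = l then σ ^ 2 else 0 :=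
    fun i l => (hM.integral_cond_noise hm (f := fun x => x i * x l) (by fun_prop)).trans
      (hM.integral_noise_mul i l)
  have hg := fun i : Fin n => measurable_groupWeights v j i
  have hg' := fun i : Fin n => measurable_groupWeights v' j' i
  have hgi := hM.integrable_cond_groupWeights hS hm v h j
  have hgi' := hM.integrable_cond_groupWeights hS hm v' h' j'
  have hU := hM.ols_ae_eq (w := w) (m := m) hS β v (fun c hc => (h c hc).le) j
  have hU' := hM.ols_ae_eq (w := w) (m := m) hS β v' (fun c hc => (h' c hc).le) j'
  have hR := integrable_noiseSum hind hg hgi hei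
  have hR' := integrable_noiseSum hind hg' hgi' hei
  have hRR := integrable_noiseSum_mul hind hg hg' hint hee
  refine ⟨((integrable_const (β v j)).add hR).congr hU.symm, ?_, ?_⟩
  · refine (((integrable_const (β v j * β v' j')).add (hR'.const_mul (β v j))).add
      ((hR.mul_const (β v' j')).add hRR)).congr ?_
    filter_upwards [hU, hU'] with ω h1 h2
    rw [h1, h2]
    simp only [Pi.add_apply]
    ring
  · rw [covariance_of_ae_eq_const_add hU hU' hR hR'
      (integral_noiseSum hM.measurable_noise_family hM.measurable_design hind hg hgi hei he0)
      (integral_noiseSum hM.measurable_noise_family hM.measurable_design hind hg' hgi' hei he0)]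
    exact integral_noiseSum_mul hM.measurable_noise_family hM.measurable_design hind hg hg' hint
      hee hev

end IsModel

end CausalOLS

end

/-! ### Assembly of the two claims. -/

theorem mainTheorem2 {Ω : Type*} [MeasurableSpace Ω] (P : Measure Ω) [IsProbabilityMeasure P]
    (n d : ℕ) (S : Matrix (Fin d) (Fin d) ℝ) (hS : S.PosDef)
    (η : EuclideanSpace ℝ (Fin d)) (β : Bool → EuclideanSpace ℝ (Fin d)) (σ : ℝ)
    (X : Fin n → Ω → EuclideanSpace ℝ (Fin d)) (W : Fin n → Ω → Bool) (ε : Fin n → Ω → ℝ)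
    (hmodel : CausalOLS.IsModel P S η σ X W ε)
    (Y : Fin n → Ω → ℝ) (hY : Y = CausalOLS.observedOutcome β X W ε) :
    -- given the group sizes, the two fits are uncorrelated
    (∀ (w : Bool) (m : ℕ), d < m → d + m < n →
      (∀ v : Bool,
        (∀ᵐ ω ∂(CausalOLS.condGroupSize P W w m), IsUnit (CausalOLS.gram X W v ω)) ∧
        ∀ j, Integrable (fun ω => CausalOLS.ols X W Y v ω j) (CausalOLS.condGroupSize P W w m)) ∧
      (∀ j k, Integrable
        (fun ω => CausalOLS.ols X W Y true ω j * CausalOLS.ols X W Y false ω k)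
        (CausalOLS.condGroupSize P W w m)) ∧
      CausalOLS.covMatrix (CausalOLS.condGroupSize P W w m)
        (CausalOLS.ols X W Y true) (CausalOLS.ols X W Y false) = 0) ∧
    -- the exact conditional variance of each fit
    (∀ (w : Bool) (m : ℕ), d + 1 < m → m ≤ n →
      (∀ᵐ ω ∂(CausalOLS.condGroupSize P W w m), IsUnit (CausalOLS.gram X W w ω)) ∧
      (∀ j, MemLp (fun ω => CausalOLS.ols X W Y w ω j) 2 (CausalOLS.condGroupSize P W w m)) ∧
      (∀ j k, Integrable (fun ω => (CausalOLS.gram X W w ω)⁻¹ j k)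
        (CausalOLS.condGroupSize P W w m)) ∧
      CausalOLS.covMatrix (CausalOLS.condGroupSize P W w m)
          (CausalOLS.ols X W Y w) (CausalOLS.ols X W Y w)
        = σ ^ 2 • CausalOLS.meanMatrix (CausalOLS.condGroupSize P W w m)
            (fun ω => (CausalOLS.gram X W w ω)⁻¹) ∧
      CausalOLS.meanMatrix (CausalOLS.condGroupSize P W w m)
          (fun ω => (CausalOLS.gram X W w ω)⁻¹)
        = ((m : ℝ) - (d : ℝ) - 1)⁻¹ • S⁻¹) := by
  subst hY
  refine ⟨fun w m h1 h2 => ?_, fun w m h1 h2 => ?_⟩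
  -- The other group has n - m units, so d < m and d + m < n say that both groups exceed d.
  · have hcard := fun (c) (hc : c ∈ CausalOLS.assignments n w m) =>
      CausalOLS.lt_card_fiber hc h1 h2
    have hm : m ≤ n := by omega
    have hint := fun j k => hmodel.integrable_cond_groupWeights_mul hS hm hcard j k
    have hmain := fun j k => hmodel.covariance_ols hS β hm true false j k
      (fun c hc => hcard c hc true) (fun c hc => hcard c hc false) (hint j k)
    refine ⟨fun v => ⟨hmodel.ae_isUnit_gram hS v fun c hc => (hcard c hc v).le, fun j => ?_⟩,
      fun j k => (hmain j k).2.1, ?_⟩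
    · cases v with
      | true => exact (hmain j j).1
      | false =>
        exact (hmodel.covariance_ols hS β hm false true j j (fun c hc => hcard c hc false)
          (fun c hc => hcard c hc true)
          fun i l => by simpa only [mul_comm] using hint j j l i).1
    · ext j k
      rw [CausalOLS.covMatrix, Matrix.of_apply, (hmain j k).2.2]
      simp [CausalOLS.groupWeights_mul_of_ne]
  · have hcard : ∀ c ∈ CausalOLS.assignments n w m, d + 1 < Fintype.card {k // c k = w} :=
      fun c hc => by
        have hcw : Fintype.card {k // c k = w} = m := hc
        omega
    have hcard' : ∀ c ∈ CausalOLS.assignments n w m, d < Fintype.card {k // c k = w} :=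
      fun c hc => by have := hcard c hc; omega
    have hunit := hmodel.ae_isUnit_gram (w := w) (m := m) hS w fun c hc => (hcard' c hc).le
    have := hmodel.isProbabilityMeasure_condGroupSize (w := w) h2
    refine ⟨hunit, fun j => ?_, hmodel.integrable_cond_gram_inv h2 w hcard, ?_, ?_⟩
    · exact ((memLp_const (β w j)).add (hmodel.memLp_noiseSum hS h2 w hcard j)).ae_eq
        (hmodel.ols_ae_eq hS β w (fun c hc => (hcard' c hc).le) j).symm
    · ext j k
      rw [CausalOLS.covMatrix, Matrix.of_apply, (hmodel.covariance_ols hS β h2 w w j k hcard' hcard'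
        (hmodel.integrable_cond_groupWeights_mul_self hS h2 w hcard j k)).2.2,
        Matrix.smul_apply, smul_eq_mul, CausalOLS.meanMatrix, Matrix.of_apply]
      congr 1
      -- The weight identity needs an invertible Gram matrix, hence holds only almost surely.
      refine integral_congr_ae (hunit.mono fun ω hω => ?_)
      simp only [CausalOLS.gram_eq_outerSum] at hω ⊢
      exact CausalOLS.sum_groupWeights_mul (u := fun i => (X i ω, W i ω)) hω j k
    · ext j k
      rw [CausalOLS.meanMatrix, Matrix.of_apply, hmodel.integral_cond_gram_inv hS h2 h1 j k,
        Matrix.smul_apply, smul_eq_mul]
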